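/- Let $\mathcal{H}$ be a Hilbert space, let $\mathcal{K}$ be the $C^*$-algebra of all compact operators on $\mathcal{H}$, and let $E$ be a (left) Hilbert $\mathcal{K}$-module. Denote by $B(E)$ the adjointable operators on $E$ and by $K(E)\subseteq B(E)$ the closed linear span of the operators $\Theta_{x,y}(z)=\langle z,x\rangle y$, $x,y\in E$. An operator $T\in B(E)$ is called Fredholm if there are $S_1,S_2\in B(E)$ with $S_1T-1\in K(E)$ and $TS_2-1\in K(E)$. A densely defined closed $\mathcal{K}$-linear operator $t:\mathrm{Dom}(t)\subseteq E\to E$ is called regular if its adjoint $t^*$ is densely defined and $1+t^*t$ has dense range. A regular operator $t$ is called Fredholm if there are $G_1,G_2\in B(E)$ such that $G_1t$ and $tG_2$ are closable, their closures belong to $B(E)$, and $\overline{G_1t}-1\in K(E)$, $\overline{tG_2}-1\in K(E)$. An orthonormal basis of a closed submodule $X\subseteq E$ is a family of pairwise orthogonal vectors $x_\lambda\in X$ that generates a dense submodule of $X$ and for which every $\langle x_\lambda,x_\lambda\rangle$ is a minimal projection of $\mathcal{K}$. The dimension $\dim_{\mathcal{K}}X$ is the cardinality of any orthonormal basis of $X$.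 Let $t$ be a regular Fredholm operator on $E$. Then the bounded transform $F_t=t(1+t^*t)^{-1/2}$ exists (and is unique) as an element of $B(E)$, its adjoint $F_t^*$ is the bounded transform $F_{t^*}$ of $t^*$, it is a Fredholm operator, and $$\mathrm{Ker}\,t=\mathrm{Ker}\,F_t,\qquad \mathrm{Ker}\,t^*=\mathrm{Ker}\,F_{t^*}=\mathrm{Ker}\,F_t^*.$$ Each of these kernels has an orthonormal basis, all orthonormal bases of the same kernel have the same cardinality, and $\dim_{\mathcal{K}}\mathrm{Ker}\,t$ and $\dim_{\mathcal{K}}\mathrm{Ker}\,t^*$ are finite. Consequently the indices $$\mathrm{ind}\,t=\dim_{\mathcal{K}}\mathrm{Ker}\,t-\dim_{\mathcal{K}}\mathrm{Ker}\,t^*,\qquad \mathrm{ind}\,F_t=\dim_{\mathcal{K}}\mathrm{Ker}\,F_t-\dim_{\mathcal{K}}\mathrm{Ker}\,F_t^*$$ are well-defined integers, and $\mathrm{ind}\,t=\mathrm{ind}\,F_t$. -/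

import Mathlib

noncomputable section

namespace HilbertModule

/-! ### The C⋆-algebra of compact operators on a Hilbert space -/

section CompactOperators

variable (H : Type*) [NormedAddCommGroup H] [InnerProductSpace ℂ H] [CompleteSpace H]

/-- The Hilbert space adjoint of a compact operator is compact. -/
theorem isCompactOperator_star {H : Type*} [NormedAddCommGroup H] [InnerProductSpace ℂ H]
    [CompleteSpace H] {T : H →L[ℂ] H} (hT : IsCompactOperator T) :
    IsCompactOperator (star T : H →L[ℂ] H) := by
  have hS : IsCompactOperator (T ∘L star T) := hT.comp_clm (star T)
  have hSb : TotallyBounded ((T ∘L star T) '' Metric.closedBall 0 1) :=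
    ((hS.isCompact_closure_image_closedBall (f := ((T ∘L star T : H →L[ℂ] H) : H →ₗ[ℂ] H))
      1).totallyBounded).subset subset_closure
  have hb : TotallyBounded ((star T : H →L[ℂ] H) '' Metric.closedBall (0 : H) 1) := by
    rw [Metric.totallyBounded_iff]
    intro ε hε
    obtain ⟨t, ht, htf, hcov⟩ :=
      Metric.finite_approx_of_totallyBounded hSb (ε ^ 2 / 2) (by positivity)
    choose! g hg hg' using fun y (hy : y ∈ t) => ht hy
    refine ⟨(fun y => star T (g y)) '' t, htf.image _, ?_⟩
    rintro _ ⟨x, hx, rfl⟩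
    obtain ⟨y, hy, hxy⟩ := Set.mem_iUnion₂.1 (hcov ⟨x, hx, rfl⟩)
    refine Set.mem_iUnion₂.2 ⟨_, ⟨y, hy, rfl⟩, ?_⟩
    rw [Metric.mem_ball, dist_eq_norm, ← hg' y hy, ← map_sub] at hxy
    rw [Metric.mem_ball, dist_eq_norm, ← map_sub]
    set z := x - g y with hz
    have hz2 : ‖z‖ ≤ 2 := by
      have h1 : ‖x‖ ≤ 1 := by simpa using hx
      have h2 : ‖g y‖ ≤ 1 := by simpa using hg y hy
      calc ‖z‖ ≤ ‖x‖ + ‖g y‖ := norm_sub_le _ _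
        _ ≤ 2 := by linarith
    have key : ‖star T z‖ ^ 2 ≤ ‖(T ∘L star T) z‖ * ‖z‖ := by
      have h := norm_inner_le_norm (𝕜 := ℂ) ((T ∘L star T) z) z
      have h2 : inner ℂ ((T ∘L star T) z) z = inner ℂ (star T z) (star T z) := by
        rw [ContinuousLinearMap.star_eq_adjoint, ContinuousLinearMap.adjoint_inner_right]
        rfl
      rw [h2, inner_self_eq_norm_sq_to_K] at h
      simpa using h
    have : ‖star T z‖ ^ 2 < ε ^ 2 := by
      have h3 : ‖(T ∘L star T) z‖ * ‖z‖ ≤ ‖(T ∘L star T) z‖ * 2 := by gcongr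
      linarith
    exact lt_of_pow_lt_pow_left₀ 2 hε.le this
  have := (isCompactOperator_iff_isCompact_closure_image_closedBall
    ((star T : H →L[ℂ] H) : H →ₗ[ℂ] H) zero_lt_one).2
    (hb.closure.isCompact_of_isClosed isClosed_closure)
  exact this

/-- The compact operators on `H`, as a ⋆-subalgebra of the bounded operators. -/
def compactSubalgebra : NonUnitalStarSubalgebra ℂ (H →L[ℂ] H) where
  carrier := {T | IsCompactOperator T}
  add_mem' hS hT := hS.add hT
  zero_mem' := isCompactOperator_zero
  mul_mem' {_ T} hS _ := hS.comp_clm T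
  smul_mem' c _ hT := hT.smul c
  star_mem' hT := isCompactOperator_star hT

/-- `𝒦(H)`, the C⋆-algebra of all compact operators on the Hilbert space `H`, with the operator
norm, the Hilbert space adjoint as involution, and the order of a C⋆-algebra. -/
def CompactOp : Type _ := compactSubalgebra H

instance : NonUnitalCStarAlgebra (CompactOp H) :=
  NonUnitalStarSubalgebra.nonUnitalCStarAlgebra (compactSubalgebra H)
    (h_closed := isClosed_setOfPred_isCompactOperator)

instance : PartialOrder (CompactOp H) := CStarAlgebra.spectralOrder (CompactOp H)

instance : StarOrderedRing (CompactOp H) := CStarAlgebra.spectralOrderedRing (CompactOp H)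

end CompactOperators

/-! ### Operators on Hilbert C⋆-modules

Modules are left modules, and Mathlib's `inner A x y` is `A`-linear in `y`; the inner product
`⟨x, y⟩` that is `A`-linear in the first variable is thus `inner A y x`. -/

section Operators

variable (A : Type*) [NonUnitalCStarAlgebra A] [PartialOrder A] [StarOrderedRing A]
variable {E : Type*} [NormedAddCommGroup E] [NormedSpace ℂ E] [SMul A E] [CStarModule A E]

theorem inner_ext {A : Type*} [NonUnitalCStarAlgebra A] [PartialOrder A]
    {E : Type*} [NormedAddCommGroup E] [NormedSpace ℂ E] [SMul A E] [CStarModule A E] {x y : E} (h : ∀ z : E, inner A z x = inner A z y) : x = y := by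
  have h0 : inner A (x - y) (x - y) = 0 := by
    rw [CStarModule.inner_sub_right, h, sub_self]
  exact sub_eq_zero.1 (CStarModule.inner_self.1 h0)

theorem norm_act_le {A : Type*} [NonUnitalCStarAlgebra A] [PartialOrder A]
    {E : Type*} [NormedAddCommGroup E] [NormedSpace ℂ E] [SMul A E] [CStarModule A E] (a : A) (x : E) : ‖a • x‖ ≤ ‖a‖ * ‖x‖ := by
  have h : ‖a • x‖ ^ 2 ≤ (‖a‖ * ‖x‖) ^ 2 := by
    rw [mul_pow, CStarModule.norm_sq_eq A (x := a • x), CStarModule.norm_sq_eq A (x := x),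
      CStarModule.inner_op_smul_left, CStarModule.inner_op_smul_right]
    calc ‖a * inner A x x * star a‖ ≤ ‖a‖ * ‖inner A x x‖ * ‖star a‖ :=
          (norm_mul_le _ _).trans (by gcongr; exact norm_mul_le _ _)
      _ = ‖a‖ ^ 2 * ‖inner A x x‖ := by rw [norm_star]; ring
  exact le_of_sq_le_sq h (by positivity)

/-- The operator `Θ_{x,y}`, mapping `z` to `⟨z, x⟩ y`. -/
def theta (x y : E) : E →L[ℂ] E :=
  LinearMap.mkContinuous
    { toFun := fun z => inner A x z • y
      map_add' := fun z w => inner_ext (A := A) fun u => by simp [add_mul]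
      map_smul' := fun c z => inner_ext (A := A) fun u => by simp [smul_mul_assoc] }
    (‖x‖ * ‖y‖) fun z => by
      calc ‖inner A x z • y‖ ≤ ‖inner A x z‖ * ‖y‖ := norm_act_le _ _
        _ ≤ ‖x‖ * ‖z‖ * ‖y‖ := by gcongr; exact CStarModule.norm_inner_le E
        _ = ‖x‖ * ‖y‖ * ‖z‖ := by ring

variable (E) in
/-- `K(E)`, the `A`-compact operators: the norm closure of the span of the `Θ_{x,y}`. -/
def moduleCompacts : Submodule ℂ (E →L[ℂ] E) :=
  (Submodule.span ℂ {T : E →L[ℂ] E | ∃ x y : E, T = theta A x y}).topologicalClosure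

variable (E) in
/-- `B(E)`, the adjointable operators on `E`. An element is an operator together with its (unique)
adjoint. -/
@[ext]
structure Adjointable where
  op : E →L[ℂ] E
  adj : E →L[ℂ] E
  inner_op_left : ∀ x y : E, inner A (op x) y = inner A x (adj y)

variable {A}

/-- The adjoint `T⋆`, as an element of `B(E)`. -/
def Adjointable.conj (T : Adjointable A E) : Adjointable A E where
  op := T.adj
  adj := T.op
  inner_op_left x y := by
    rw [← CStarModule.star_inner y, ← T.inner_op_left, CStarModule.star_inner]

/-- An adjointable operator as an everywhere defined operator. -/
def Adjointable.toPMap (T : Adjointable A E) : E →ₗ.[ℂ] E :=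
  (T.op : E →ₗ[ℂ] E).toPMap ⊤

/-- A bounded operator `T` is Fredholm if it has left and right inverses modulo `K(E)`. -/
def Adjointable.IsFredholm (T : Adjointable A E) : Prop :=
  (∃ S : Adjointable A E, S.op ∘L T.op - ContinuousLinearMap.id ℂ E ∈ moduleCompacts A E) ∧
  ∃ S : Adjointable A E, T.op ∘L S.op - ContinuousLinearMap.id ℂ E ∈ moduleCompacts A E

/-- The composition `t s` with `Dom (t s) = {x ∈ Dom s | s x ∈ Dom t}`. -/
def pcomp (t s : E →ₗ.[ℂ] E) : E →ₗ.[ℂ] E :=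
  t.comp (s.domRestrict ((t.domain.comap s.toFun).map s.domain.subtype)) (by
    intro x
    obtain ⟨y, hy, hyx⟩ := Submodule.mem_map.1 x.2.1
    have h : s.domRestrict _ x = s y := LinearPMap.domRestrict_apply hyx.symm
    rw [h]
    exact hy)

/-- `Ker t = {x ∈ Dom t | t x = 0}`. -/
def pker (t : E →ₗ.[ℂ] E) : Submodule ℂ E :=
  (LinearMap.ker t.toFun).map t.domain.subtype

variable (A) in
/-- The pairs `(y, y')` with `⟨t x, y⟩ = ⟨x, y'⟩` for all `x ∈ Dom t`. -/
def adjointGraph (t : E →ₗ.[ℂ] E) : Submodule ℂ (E × E) where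
  carrier := {p | ∀ x : t.domain, inner A (t x) p.1 = inner A (x : E) p.2}
  add_mem' {p q} hp hq x := by simp [hp x, hq x]
  zero_mem' x := by simp
  smul_mem' c p hp x := by simp [hp x]

variable (A) in
/-- The adjoint `t⋆` of a densely defined operator `t`: its domain consists of all `y` for which
there is a `y'` with `⟨t x, y⟩ = ⟨x, y'⟩` for all `x ∈ Dom t`, and then `t⋆ y = y'`. -/
def padjoint (t : E →ₗ.[ℂ] E) : E →ₗ.[ℂ] E :=
  (adjointGraph A t).toLinearPMap

variable (A) in
/-- The operator `1 + t⋆ t`, with domain `Dom (t⋆ t)`. -/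
def oneAddAdjointMul (t : E →ₗ.[ℂ] E) : E →ₗ.[ℂ] E :=
  (LinearMap.id : E →ₗ[ℂ] E) +ᵥ pcomp (padjoint A t) t

variable (A) in
/-- Regular operators on a Hilbert `A`-module. -/
structure IsRegular (t : E →ₗ.[ℂ] E) : Prop where
  /-- `t` is `A`-linear, and its domain is a submodule -/
  smul_mem : ∀ (a : A) (x y : E), (x, y) ∈ t.graph → (a • x, a • y) ∈ t.graph
  isClosed : t.IsClosed
  dense_domain : Dense (t.domain : Set E)
  dense_adjoint_domain : Dense ((padjoint A t).domain : Set E)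
  dense_range : Dense (LinearMap.range (oneAddAdjointMul A t).toFun : Set E)

/-- `G` is a pseudo left inverse of `t`. -/
def IsPseudoLeftInverse (G : Adjointable A E) (t : E →ₗ.[ℂ] E) : Prop :=
  (pcomp G.toPMap t).IsClosable ∧ ∃ S : Adjointable A E,
    (pcomp G.toPMap t).closure = S.toPMap ∧
      S.op - ContinuousLinearMap.id ℂ E ∈ moduleCompacts A E

/-- `G` is a pseudo right inverse of `t`. -/
def IsPseudoRightInverse (G : Adjointable A E) (t : E →ₗ.[ℂ] E) : Prop :=
  (pcomp t G.toPMap).IsClosable ∧ ∃ S : Adjointable A E,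
    (pcomp t G.toPMap).closure = S.toPMap ∧
      S.op - ContinuousLinearMap.id ℂ E ∈ moduleCompacts A E

variable (A) in
/-- A regular operator is Fredholm if it has a pseudo left and a pseudo right inverse. -/
def IsFredholm (t : E →ₗ.[ℂ] E) : Prop :=
  (∃ G : Adjointable A E, IsPseudoLeftInverse G t) ∧
    ∃ G : Adjointable A E, IsPseudoRightInverse G t

/-- `Q = (1 + t⋆ t)^{-1/2}`: `Q` is positive and its square is the inverse of `1 + t⋆ t`. -/
def IsInvSqrt (t : E →ₗ.[ℂ] E) (Q : Adjointable A E) : Prop :=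
  (∀ x : E, 0 ≤ inner A x (Q.op x)) ∧
    pcomp Q.toPMap Q.toPMap = (oneAddAdjointMul A t).inverse

/-- `F` is the bounded transform `F_t = t (1 + t⋆ t)^{-1/2}` of `t`. -/
def IsBoundedTransform (t : E →ₗ.[ℂ] E) (F : Adjointable A E) : Prop :=
  ∃ Q : Adjointable A E, IsInvSqrt t Q ∧ F.toPMap = pcomp t Q.toPMap

/-! ### Orthonormal dimension and index -/

/-- A minimal projection: a nonzero projection `p` with `p A p = ℂ p`. -/
def IsMinimalProjection (p : A) : Prop :=
  IsStarProjection p ∧ p ≠ 0 ∧ ∀ a : A, ∃ c : ℂ, p * a * p = c • p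

variable (A) in
/-- `B` is an orthonormal basis of the closed submodule `X` of `E`: the elements `x` of `B` are
basic vectors (`⟨x, x⟩` is a minimal projection), distinct elements are orthogonal, and the
`A`-submodule generated by `B` is dense in `X`. -/
structure IsOrthonormalBasis (X : Submodule ℂ E) (B : Set E) : Prop where
  basic : ∀ x ∈ B, IsMinimalProjection (inner A x x)
  orthogonal : ∀ x ∈ B, ∀ y ∈ B, x ≠ y → inner A x y = 0
  dense_span : (Submodule.span ℂ (B ∪ {z | ∃ (a : A), ∃ x ∈ B, z = a • x})).topologicalClosure = X

variable (A) in
/-- `X` has an orthonormal basis, and all its orthonormal bases have cardinality `c`. -/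
def HasOrthonormalDim (X : Submodule ℂ E) (c : Cardinal) : Prop :=
  (∃ B : Set E, IsOrthonormalBasis A X B) ∧
    ∀ B : Set E, IsOrthonormalBasis A X B → Cardinal.mk B = c

variable (A) in
/-- The orthonormal dimension: the cardinality of any orthonormal basis (for definiteness, the
smallest one). -/
def orthonormalDim (X : Submodule ℂ E) : Cardinal :=
  sInf {c | ∃ B : Set E, IsOrthonormalBasis A X B ∧ Cardinal.mk B = c}

variable (A) in
/-- `ind t = dim Ker t - dim Ker t⋆`, meaningful if both dimensions are finite. -/
def index (t : E →ₗ.[ℂ] E) : ℤ :=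
  (Cardinal.toNat (orthonormalDim A (pker t)) : ℤ) -
    Cardinal.toNat (orthonormalDim A (pker (padjoint A t)))

/-- `ind T = dim Ker T - dim Ker T⋆` for a bounded operator `T`, meaningful if both dimensions are
finite. -/
def Adjointable.index (T : Adjointable A E) : ℤ :=
  (Cardinal.toNat (orthonormalDim A (LinearMap.ker (T.op : E →ₗ[ℂ] E))) : ℤ) -
    Cardinal.toNat (orthonormalDim A (LinearMap.ker (T.conj.op : E →ₗ[ℂ] E)))

end Operators

end HilbertModule

end

/-! The unbounded `t` is encoded by bounded operators. Regularity makes R = (1 + t⋆t)⁻¹ and S = tR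
bounded and everywhere defined. With Q = R^{1/2}, the map Qw ↦ Sw is contractive on a dense subspace
and extends to F, and the graph of t is exactly {(Qy, Fy)} (`IsRegular.exists_transform`). With Q' =
1 - F(1 + Q)⁻¹F⋆ one has Q² + F⋆F = 1, Q'² + FF⋆ = 1 and FQ = Q'F (`IsTransformData`). These
relations are symmetric in t and t⋆. They show that t⋆ has graph {(Q'y, F⋆y)} and that (1 + t⋆t)⁻¹ =
Q², and since Q fixes Ker F they give Ker t = Ker F. By symmetry Ker t⋆ = Ker F⋆, so both indices
are computed from the same two submodules.

Fredholmness passes to F by explicit parametrices built from Q, F and those of t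
(`IsTransformData.isFredholm`).

For the dimensions, fix a unit vector ξ and e = |ξ⟩⟨ξ|. Since e𝒦e = ℂe, the corner eX of a closed
submodule X carries a scalar inner product. When eX is finite-dimensional, an orthonormal basis of
it is one of X, and every orthonormal basis of X can be rotated into one of eX, so the dimension of
X is dim_ℂ eX (`exists_isOrthonormalBasis`, `IsOrthonormalBasis.mk_eq_finrank`). Module-compact
operators restrict to compact operators on eX. On the kernel of a Fredholm operator one of them is
the identity, which forces eX to be finite-dimensional. -/

namespace HilbertModule

/-! ### Adjoint pairs of bounded operators -/

section AdjointPairs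

variable (A : Type*) [NonUnitalCStarAlgebra A] [PartialOrder A]
variable {E : Type*} [NormedAddCommGroup E] [NormedSpace ℂ E] [SMul A E] [CStarModule A E]

/-- `S` is an adjoint of the bounded operator `T`. -/
def IsAdjPair (T S : E →L[ℂ] E) : Prop := ∀ x y : E, inner A (T x) y = inner A x (S y)

variable {A}

theorem inner_ext_left {x y : E} (h : ∀ z : E, inner A x z = inner A y z) : x = y :=
  inner_ext (A := A) fun z => by rw [← CStarModule.star_inner, h, CStarModule.star_inner]

theorem IsAdjPair.symm {T S : E →L[ℂ] E} (h : IsAdjPair A T S) : IsAdjPair A S T := fun x y => by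
  rw [← CStarModule.star_inner y, ← h, CStarModule.star_inner]

theorem IsAdjPair.inner_right {T S : E →L[ℂ] E} (h : IsAdjPair A T S) (x y : E) :
    inner A x (T y) = inner A (S x) y := (h.symm x y).symm

theorem IsAdjPair.unique {T S S' : E →L[ℂ] E} (h : IsAdjPair A T S) (h' : IsAdjPair A T S') :
    S = S' :=
  ContinuousLinearMap.ext fun y => inner_ext (A := A) fun x => by rw [← h, ← h']

theorem IsAdjPair.one : IsAdjPair A (1 : E →L[ℂ] E) 1 := fun _ _ => rfl

theorem IsAdjPair.mul {T S T' S' : E →L[ℂ] E} (h : IsAdjPair A T S) (h' : IsAdjPair A T' S') :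
    IsAdjPair A (T * T') (S' * S) := fun x y => by
  simp [h _ _, h' _ _]

theorem IsAdjPair.add {T S T' S' : E →L[ℂ] E} (h : IsAdjPair A T S) (h' : IsAdjPair A T' S') :
    IsAdjPair A (T + T') (S + S') := fun x y => by
  simp [h _ _, h' _ _]

theorem IsAdjPair.sub {T S T' S' : E →L[ℂ] E} (h : IsAdjPair A T S) (h' : IsAdjPair A T' S') :
    IsAdjPair A (T - T') (S - S') := fun x y => by
  simp [h _ _, h' _ _]

theorem IsAdjPair.smul {T S : E →L[ℂ] E} (c : ℂ) (h : IsAdjPair A T S) :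
    IsAdjPair A (c • T) (star c • S) := fun x y => by
  simp [h _ _]

theorem IsAdjPair.map_act {T S : E →L[ℂ] E} (h : IsAdjPair A T S) (a : A) (x : E) :
    T (a • x) = a • T x :=
  inner_ext (A := A) fun z => by simp [h.inner_right]

theorem Adjointable.isAdjPair (T : Adjointable A E) : IsAdjPair A T.op T.adj := T.inner_op_left

theorem Adjointable.ext_op {T S : Adjointable A E} (h : T.op = S.op) : T = S :=
  Adjointable.ext h (T.isAdjPair.unique (h ▸ S.isAdjPair))

/-- An operator with vanishing quadratic form is zero. -/
theorem eq_zero_of_inner_self_eq_zero {T : E →L[ℂ] E} (h : ∀ x, inner A x (T x) = 0) : T = 0 := by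
  refine ContinuousLinearMap.ext fun y => inner_ext (A := A) fun x => ?_
  -- Polarization: x + y gives ⟨y, Tx⟩ = -⟨x, Ty⟩, and then x + iy gives 2i⟨x, Ty⟩ = 0.
  have h1 := h (x + y)
  have h2 := h (x + Complex.I • y)
  simp only [map_add, map_smul, CStarModule.inner_add_left, CStarModule.inner_add_right,
    CStarModule.inner_smul_left_complex, CStarModule.inner_smul_right_complex, h, smul_zero,
    add_zero, zero_add] at h1 h2
  have h3 : inner A y (T x) = - inner A x (T y) := eq_neg_of_add_eq_zero_left (by rw [← h1, add_comm])
  rw [h3] at h2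
  have h4 : (2 * Complex.I) • inner A x (T y) = 0 := by
    rw [← h2]; simp [two_mul, add_smul]
  simpa using h4

/-- Positive elements of `A` are self-adjoint, so T and its adjoint have the same quadratic form.
This recovers self-adjointness from the positivity clause of `IsInvSqrt`. -/
theorem IsAdjPair.eq_of_nonneg [StarOrderedRing A] {T S : E →L[ℂ] E} (h : IsAdjPair A T S)
    (hT : ∀ x, 0 ≤ inner A x (T x)) : S = T := by
  refine (sub_eq_zero.1 (eq_zero_of_inner_self_eq_zero (A := A) fun x => ?_)).symm
  have : IsSelfAdjoint (inner A x (T x)) := IsSelfAdjoint.of_nonneg (hT x)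
  rw [sub_apply, CStarModule.inner_sub_right, ← h, sub_eq_zero,
    ← CStarModule.star_inner x]
  exact this.star_eq.symm

end AdjointPairs

/-! ### The C⋆-algebra of adjointable operators -/

section CStarAlgebra

variable (A : Type*) [NonUnitalCStarAlgebra A] [PartialOrder A]
variable (E : Type*) [NormedAddCommGroup E] [NormedSpace ℂ E] [SMul A E] [CStarModule A E]

/-- The adjointable operators as a subalgebra of all bounded operators. -/
def adjointableSubalgebra : Subalgebra ℂ (E →L[ℂ] E) where
  carrier := {T | ∃ S, IsAdjPair A T S}
  mul_mem' := fun ⟨_, h⟩ ⟨_, h'⟩ => ⟨_, h.mul h'⟩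
  add_mem' := fun ⟨_, h⟩ ⟨_, h'⟩ => ⟨_, h.add h'⟩
  algebraMap_mem' c := ⟨star c • 1, by
    rw [Algebra.algebraMap_eq_smul_one]; exact IsAdjPair.one.smul c⟩

variable {A E}

noncomputable instance : Star (adjointableSubalgebra A E) where
  star T := ⟨T.2.choose, T.1, T.2.choose_spec.symm⟩

theorem isAdjPair_star (T : adjointableSubalgebra A E) :
    IsAdjPair A (T : E →L[ℂ] E) (star T : adjointableSubalgebra A E) := T.2.choose_spec

theorem star_eq_of_isAdjPair {T S : adjointableSubalgebra A E}
    (h : IsAdjPair A (T : E →L[ℂ] E) S) : star T = S :=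
  Subtype.ext ((isAdjPair_star T).unique h)

noncomputable instance : StarRing (adjointableSubalgebra A E) where
  star_involutive T := star_eq_of_isAdjPair (isAdjPair_star T).symm
  star_mul T S := star_eq_of_isAdjPair ((isAdjPair_star T).mul (isAdjPair_star S))
  star_add T S := star_eq_of_isAdjPair ((isAdjPair_star T).add (isAdjPair_star S))

theorem isSelfAdjoint_iff_isAdjPair {T : adjointableSubalgebra A E} :
    IsSelfAdjoint T ↔ IsAdjPair A (T : E →L[ℂ] E) T :=
  ⟨fun h => by simpa only [h.star_eq] using isAdjPair_star T, star_eq_of_isAdjPair⟩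

variable [StarOrderedRing A]

/-- The C⋆-inequality: Cauchy–Schwarz applied to ⟨Tx, Tx⟩ = ⟨x, STx⟩. -/
theorem IsAdjPair.norm_sq_le {T S : E →L[ℂ] E} (h : IsAdjPair A T S) :
    ‖T‖ * ‖T‖ ≤ ‖S * T‖ := by
  rw [← sq, ← Real.le_sqrt (norm_nonneg _) (norm_nonneg _)]
  refine T.opNorm_le_bound (Real.sqrt_nonneg _) fun x => ?_
  refine le_of_sq_le_sq ?_ (by positivity)
  rw [mul_pow, Real.sq_sqrt (norm_nonneg _), CStarModule.norm_sq_eq A, h]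
  calc ‖inner A x (S (T x))‖ ≤ ‖x‖ * ‖(S * T) x‖ := CStarModule.norm_inner_le E
    _ ≤ ‖x‖ * (‖S * T‖ * ‖x‖) := by gcongr; exact (S * T).le_opNorm x
    _ = ‖S * T‖ * ‖x‖ ^ 2 := by ring

theorem IsAdjPair.norm_le {T S : E →L[ℂ] E} (h : IsAdjPair A T S) : ‖T‖ ≤ ‖S‖ := by
  rcases eq_or_lt_of_le (norm_nonneg T) with h0 | h0
  · rw [← h0]; exact norm_nonneg S
  · exact le_of_mul_le_mul_right (h.norm_sq_le.trans (norm_mul_le S T)) h0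

-- Passing to adjoints does not increase the norm, so the adjoints of a convergent sequence are
-- Cauchy; their limit is an adjoint by continuity of the inner product.
variable (A E) in
theorem isClosed_adjointableSubalgebra [CompleteSpace E] :
    IsClosed (adjointableSubalgebra A E : Set (E →L[ℂ] E)) := by
  refine isClosed_of_closure_subset fun T hT => ?_
  obtain ⟨u, hu, huT⟩ := mem_closure_iff_seq_limit.1 hT
  choose v hv using hu
  have hc : CauchySeq v := by
    rw [Metric.cauchySeq_iff]
    intro ε hε
    obtain ⟨N, hN⟩ := Metric.cauchySeq_iff.1 huT.cauchySeq ε hε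
    refine ⟨N, fun m hm n hn => lt_of_le_of_lt ?_ (hN m hm n hn)⟩
    rw [dist_eq_norm, dist_eq_norm]
    exact ((hv m).sub (hv n)).symm.norm_le
  obtain ⟨S, hS⟩ := cauchySeq_tendsto_of_complete hc
  refine ⟨S, fun x y => ?_⟩
  have h1 : Filter.Tendsto (fun n => inner A (u n x) y) Filter.atTop (nhds (inner A (T x) y)) :=
    ((CStarModule.continuous_inner (A := A) (E := E)).tendsto (T x, y)).comp
      ((((ContinuousLinearMap.apply ℂ E x).continuous.tendsto T).comp huT).prodMk_nhds
        tendsto_const_nhds)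
  have h2 : Filter.Tendsto (fun n => inner A x (v n y)) Filter.atTop (nhds (inner A x (S y))) :=
    ((CStarModule.continuous_inner (A := A) (E := E)).tendsto (x, S y)).comp
      (tendsto_const_nhds.prodMk_nhds
        (((ContinuousLinearMap.apply ℂ E y).continuous.tendsto S).comp hS))
  exact tendsto_nhds_unique h1 (h2.congr fun n => (hv n x y).symm)

noncomputable instance [CompleteSpace E] : CStarAlgebra (adjointableSubalgebra A E) where
  star_smul c T := star_eq_of_isAdjPair ((isAdjPair_star T).smul c)
  norm_mul_self_le T := (isAdjPair_star T).norm_sq_le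
  complete := (isClosed_adjointableSubalgebra A E).completeSpace_coe.complete

noncomputable instance [CompleteSpace E] : PartialOrder (adjointableSubalgebra A E) :=
  CStarAlgebra.spectralOrder _

instance [CompleteSpace E] : StarOrderedRing (adjointableSubalgebra A E) :=
  CStarAlgebra.spectralOrderedRing _

/-- Spectral positivity makes functional calculus available, while the definitions speak of
quadratic forms. For the converse, the negative part N satisfies NTN = -N³; both NTN and N³ have
nonnegative forms, so N³ = 0 and N = 0. -/
theorem nonneg_iff_inner_nonneg [CompleteSpace E] {T : adjointableSubalgebra A E} :
    0 ≤ T ↔ ∀ x : E, 0 ≤ inner A x ((T : E →L[ℂ] E) x) := by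
  have key : ∀ {T : adjointableSubalgebra A E}, 0 ≤ T →
      ∀ x : E, 0 ≤ inner A x ((T : E →L[ℂ] E) x) := fun {T} h x => by
    obtain ⟨S, rfl⟩ := CStarAlgebra.nonneg_iff_eq_star_mul_self.1 h
    have := isAdjPair_star S x ((S : E →L[ℂ] E) x)
    simp only [MulMemClass.coe_mul, mul_apply_eq_comp]
    rw [← this]
    exact CStarModule.inner_self_nonneg
  refine ⟨key, fun h => ?_⟩
  have hsa : IsSelfAdjoint T := by
    have h' := isAdjPair_star T
    exact Subtype.ext (h'.eq_of_nonneg h)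
  rw [← CFC.negPart_eq_zero_iff T hsa]
  set N := T⁻ with hN
  have hN0 : 0 ≤ N := CFC.negPart_nonneg T
  have hNsa : IsSelfAdjoint N := IsSelfAdjoint.of_nonneg hN0
  have hNa := isSelfAdjoint_iff_isAdjPair.1 hNsa
  have hT : N * T * N = -(N * N * N) := by
    conv_lhs => rw [← CFC.posPart_sub_negPart T hsa]
    rw [mul_sub, CFC.negPart_mul_posPart, zero_sub, neg_mul]
  have h3 : 0 ≤ N * N * N := by
    simpa [hNsa.star_eq] using star_left_conjugate_nonneg hN0 N
  have hz : N * N * N = 0 := by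
    refine Subtype.ext (eq_zero_of_inner_self_eq_zero (A := A) fun x => ?_)
    refine le_antisymm ?_ (key h3 x)
    have h4 := h ((N : E →L[ℂ] E) x)
    rw [hNa] at h4
    have h5 : (N : E →L[ℂ] E) ((T : E →L[ℂ] E) ((N : E →L[ℂ] E) x)) =
        -((N * N * N : adjointableSubalgebra A E) : E →L[ℂ] E) x :=
      congrArg (fun U : adjointableSubalgebra A E => (U : E →L[ℂ] E) x) hT
    rw [h5, CStarModule.inner_neg_right] at h4
    simpa using h4
  have h6 : N * N = 0 := by
    have : star (N * N) * (N * N) = 0 := by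
      rw [star_mul, hNsa.star_eq, ← mul_assoc, hz, zero_mul]
    exact CStarRing.star_mul_self_eq_zero_iff _ |>.1 this
  exact CStarRing.star_mul_self_eq_zero_iff _ |>.1 (by rwa [hNsa.star_eq])

/-- A positive adjointable operator has a positive square root. -/
theorem exists_sqrt [CompleteSpace E] {R : E →L[ℂ] E} (hR : IsAdjPair A R R)
    (hpos : ∀ x, 0 ≤ inner A x (R x)) :
    ∃ Q : E →L[ℂ] E, IsAdjPair A Q Q ∧ (∀ x, 0 ≤ inner A x (Q x)) ∧ Q * Q = R := by
  let R' : adjointableSubalgebra A E := ⟨R, R, hR⟩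
  have h0 : 0 ≤ R' := nonneg_iff_inner_nonneg.2 hpos
  have hs : 0 ≤ CFC.sqrt R' := CFC.sqrt_nonneg R'
  exact ⟨(CFC.sqrt R' : adjointableSubalgebra A E), isSelfAdjoint_iff_isAdjPair.1 (IsSelfAdjoint.of_nonneg hs),
    nonneg_iff_inner_nonneg.1 hs, congrArg Subtype.val (CFC.sqrt_mul_sqrt_self R' h0)⟩

/-- Positive square roots are unique. -/
theorem eq_of_mul_self_eq [CompleteSpace E] {Q Q' : E →L[ℂ] E} (hQ : IsAdjPair A Q Q)
    (hQ' : IsAdjPair A Q' Q') (hpos : ∀ x, 0 ≤ inner A x (Q x))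
    (hpos' : ∀ x, 0 ≤ inner A x (Q' x)) (h : Q * Q = Q' * Q') : Q = Q' := by
  let U : adjointableSubalgebra A E := ⟨Q, Q, hQ⟩
  let U' : adjointableSubalgebra A E := ⟨Q', Q', hQ'⟩
  have h1 : U * U = U' * U' := Subtype.ext h
  exact congrArg Subtype.val ((CFC.mul_self_eq_mul_self_iff U U'
    (nonneg_iff_inner_nonneg.2 hpos) (nonneg_iff_inner_nonneg.2 hpos')).1 h1)

/-- `1 + Q` has an adjointable inverse for positive `Q`. -/
theorem exists_inv_one_add [CompleteSpace E] {Q : E →L[ℂ] E} (hQ : IsAdjPair A Q Q)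
    (hpos : ∀ x, 0 ≤ inner A x (Q x)) :
    ∃ M : E →L[ℂ] E, IsAdjPair A M M ∧ (1 + Q) * M = 1 ∧ M * (1 + Q) = 1 := by
  let U : adjointableSubalgebra A E := ⟨Q, Q, hQ⟩
  have hU : 0 ≤ U := nonneg_iff_inner_nonneg.2 hpos
  have h1 : IsUnit (1 + U) := CStarAlgebra.isUnit_of_le 1 (le_add_of_nonneg_right hU)
  obtain ⟨V, hV⟩ := h1
  have h2 : (1 + U) * (↑V⁻¹ : adjointableSubalgebra A E) = 1 := by rw [← hV]; simp
  have h3 : (↑V⁻¹ : adjointableSubalgebra A E) * (1 + U) = 1 := by rw [← hV]; simp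
  have hsa : IsSelfAdjoint (1 + U) := (IsSelfAdjoint.one _).add (IsSelfAdjoint.of_nonneg hU)
  have h4 : IsSelfAdjoint (↑V⁻¹ : adjointableSubalgebra A E) := by
    have h5 : star (↑V⁻¹ : adjointableSubalgebra A E) * (1 + U) = 1 := by
      rw [← hsa.star_eq, ← star_mul, h2, star_one]
    exact left_inv_eq_right_inv h5 h2
  exact ⟨(↑V⁻¹ : adjointableSubalgebra A E), isSelfAdjoint_iff_isAdjPair.1 h4,
    congrArg Subtype.val h2, congrArg Subtype.val h3⟩

end CStarAlgebra

/-! ### Graphs of partially defined operators -/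

section Graphs

variable {A : Type*} [NonUnitalCStarAlgebra A] [PartialOrder A]
variable {E : Type*} [NormedAddCommGroup E] [NormedSpace ℂ E] [SMul A E] [CStarModule A E]

theorem mem_graph_toPMap {T : Adjointable A E} {x y : E} :
    (x, y) ∈ T.toPMap.graph ↔ y = T.op x := by
  rw [LinearPMap.mem_graph_iff]
  constructor
  · rintro ⟨z, hz, h⟩
    dsimp only at hz h
    rw [← h, ← hz]; rfl
  · rintro rfl
    exact ⟨⟨x, trivial⟩, rfl, rfl⟩

/-- Composition becomes composition of relations, which removes all bookkeeping of domains. -/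
theorem mem_graph_pcomp {t s : E →ₗ.[ℂ] E} {x z : E} :
    (x, z) ∈ (pcomp t s).graph ↔ ∃ y, (x, y) ∈ s.graph ∧ (y, z) ∈ t.graph := by
  have happ : ∀ (w : (pcomp t s).domain) (h : (w : E) ∈ s.domain),
      (s ⟨w, h⟩, pcomp t s w) ∈ t.graph := by
    intro w h
    have h1 : s.domRestrict ((t.domain.comap s.toFun).map s.domain.subtype) w = s ⟨w, h⟩ :=
      LinearPMap.domRestrict_apply rfl
    rw [LinearPMap.mem_graph_iff]
    exact ⟨⟨s.domRestrict ((t.domain.comap s.toFun).map s.domain.subtype) w, by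
      rw [h1]
      obtain ⟨y, hy, hyx⟩ := Submodule.mem_map.1 w.2.1
      have : y = ⟨w, h⟩ := Subtype.ext hyx
      rw [← this]; exact hy⟩, h1, rfl⟩
  constructor
  · intro h
    obtain ⟨w, hw, hz⟩ := (LinearPMap.mem_graph_iff _).1 h
    dsimp only at hw hz
    subst hw hz
    exact ⟨s ⟨w, w.2.2⟩, LinearPMap.mem_graph s ⟨w, w.2.2⟩, happ w w.2.2⟩
  · rintro ⟨y, h1, h2⟩
    obtain ⟨w, hw, hy⟩ := (LinearPMap.mem_graph_iff _).1 h1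
    dsimp only at hw hy
    subst hw hy
    have hd : (w : E) ∈ (pcomp t s).domain :=
      ⟨Submodule.mem_map.2 ⟨w, LinearPMap.mem_domain_of_mem_graph h2, rfl⟩, w.2⟩
    have h3 := happ ⟨w, hd⟩ w.2
    have h4 := LinearPMap.mem_graph_snd_inj t h3 h2 rfl
    rw [← h4]
    exact LinearPMap.mem_graph (pcomp t s) ⟨w, hd⟩

theorem mem_pker {t : E →ₗ.[ℂ] E} {x : E} : x ∈ pker t ↔ (x, 0) ∈ t.graph := by
  rw [pker, Submodule.mem_map, LinearPMap.mem_graph_iff]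
  exact ⟨fun ⟨y, hy, h⟩ => ⟨y, h, hy⟩, fun ⟨y, h, hy⟩ => ⟨y, hy, h⟩⟩

theorem mem_graph_one_add {t : E →ₗ.[ℂ] E} {x w : E} :
    (x, w) ∈ (oneAddAdjointMul A t).graph ↔
      ∃ u, (x, u) ∈ t.graph ∧ (u, w - x) ∈ (padjoint A t).graph := by
  rw [← mem_graph_pcomp, LinearPMap.mem_graph_iff, LinearPMap.mem_graph_iff]
  constructor
  · rintro ⟨y, h, hy⟩
    refine ⟨y, h, ?_⟩
    dsimp only at h hy ⊢
    rw [← hy, ← h]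
    exact (add_sub_cancel_left (y : E) _).symm
  · rintro ⟨y, h, hy⟩
    refine ⟨y, h, ?_⟩
    dsimp only at h hy ⊢
    have : oneAddAdjointMul A t y = (y : E) + pcomp (padjoint A t) t y := rfl
    rw [this, hy, h, add_sub_cancel]

theorem mem_adjointGraph {t : E →ₗ.[ℂ] E} {z z' : E} :
    (z, z') ∈ adjointGraph A t ↔
      ∀ x u : E, (x, u) ∈ t.graph → inner A u z = inner A x z' := by
  constructor
  · intro h x u hxu
    obtain ⟨y, hy, hu⟩ := (LinearPMap.mem_graph_iff _).1 hxu
    dsimp only at hy hu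
    rw [← hy, ← hu]
    exact h y
  · intro h x
    exact h x (t x) (LinearPMap.mem_graph t x)

end Graphs

section Graphs

variable {A : Type*} [NonUnitalCStarAlgebra A] [PartialOrder A] [StarOrderedRing A]
variable {E : Type*} [NormedAddCommGroup E] [NormedSpace ℂ E] [SMul A E] [CStarModule A E]

theorem continuous_inner_right (x : E) : Continuous fun y : E => inner A x y :=
  (CStarModule.continuous_inner (A := A) (E := E)).comp (by fun_prop : Continuous fun y => (x, y))

theorem continuous_inner_left (y : E) : Continuous fun x : E => inner A x y :=
  (CStarModule.continuous_inner (A := A) (E := E)).comp (by fun_prop : Continuous fun x => (x, y))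

theorem inner_ext_of_dense {D : Set E} (hD : Dense D) {x y : E}
    (h : ∀ z ∈ D, inner A z x = inner A z y) : x = y :=
  inner_ext (A := A) fun z => congrFun
    (Continuous.ext_on hD (continuous_inner_left x) (continuous_inner_left y) h) z

/-- Density of the domain makes the adjoint relation single-valued, so `toLinearPMap` returns an
operator with this very graph. -/
theorem graph_padjoint {t : E →ₗ.[ℂ] E} (hd : Dense (t.domain : Set E)) :
    (padjoint A t).graph = adjointGraph A t := by
  refine Submodule.toLinearPMap_graph_eq _ ?_
  rintro ⟨z, z'⟩ h rfl
  refine inner_ext_of_dense (A := A) hd fun x hx => ?_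
  have := h ⟨x, hx⟩
  dsimp only at this
  rw [← this]
  simp

theorem isClosed_adjointGraph (t : E →ₗ.[ℂ] E) :
    IsClosed (adjointGraph A t : Set (E × E)) := by
  have : (adjointGraph A t : Set (E × E)) =
      ⋂ x : t.domain, {p : E × E | inner A (t x) p.1 = inner A (x : E) p.2} := by
    ext p; simp [adjointGraph]
  rw [this]
  exact isClosed_iInter fun x => isClosed_eq ((continuous_inner_right (t x)).comp continuous_fst)
    ((continuous_inner_right (x : E)).comp continuous_snd)

theorem norm_le_norm_of_inner_le {x y : E} (h : inner A x x ≤ inner A y y) : ‖x‖ ≤ ‖y‖ := by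
  refine le_of_sq_le_sq ?_ (norm_nonneg y)
  rw [CStarModule.norm_sq_eq A, CStarModule.norm_sq_eq A]
  exact CStarAlgebra.norm_le_norm_of_nonneg_of_le CStarModule.inner_self_nonneg h

end Graphs

/-! ### Everywhere defined operators from bounded relations -/

/-- A linear relation with dense domain that is bounded contains in its closure the graph of an
everywhere defined bounded operator. -/
theorem exists_clm_of_bounded_relation {E F : Type*} [NormedAddCommGroup E] [NormedSpace ℂ E]
    [CompleteSpace E] [NormedAddCommGroup F] [NormedSpace ℂ F] [CompleteSpace F]
    (G : Submodule ℂ (E × F)) (hd : Dense (Prod.fst '' (G : Set (E × F)))) (C : ℝ)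
    (hC : ∀ p ∈ G, ‖p.2‖ ≤ C * ‖p.1‖) :
    ∃ T : E →L[ℂ] F, ∀ x, (x, T x) ∈ G.topologicalClosure := by
  have hC' : ∀ p ∈ G.topologicalClosure, ‖p.2‖ ≤ C * ‖p.1‖ := by
    have hcl : IsClosed {p : E × F | ‖p.2‖ ≤ C * ‖p.1‖} :=
      isClosed_le (by fun_prop) (by fun_prop)
    exact fun p hp => closure_minimal hC hcl hp
  let φ : G.topologicalClosure →L[ℂ] E :=
    (ContinuousLinearMap.fst ℂ E F).comp G.topologicalClosure.subtypeL
  -- The first projection is bounded below on the closed relation, so its range is closed as well as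
  -- dense. The constant `max 1 C` matches the sup norm on the product.
  have hanti : AntilipschitzWith (Real.toNNReal (max 1 C)) φ := by
    refine ContinuousLinearMap.antilipschitz_of_bound φ fun p => ?_
    rw [Real.coe_toNNReal _ (le_max_of_le_left zero_le_one)]
    change max ‖(p : E × F).1‖ ‖(p : E × F).2‖ ≤ max 1 C * ‖(p : E × F).1‖
    refine max_le ?_ ((hC' p p.2).trans ?_)
    · exact le_mul_of_one_le_left (norm_nonneg _) (le_max_left _ _)
    · gcongr; exact le_max_right _ _
  have : CompleteSpace G.topologicalClosure :=
    G.isClosed_topologicalClosure.completeSpace_coe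
  have hsurj : Function.Surjective φ := by
    rw [← Set.range_eq_univ, ← (hanti.isClosed_range φ.uniformContinuous).closure_eq]
    refine Dense.closure_eq (hd.mono ?_)
    rintro _ ⟨p, hp, rfl⟩
    exact ⟨⟨p, G.le_topologicalClosure hp⟩, rfl⟩
  let e := LinearEquiv.ofBijective (φ : G.topologicalClosure →ₗ[ℂ] E) ⟨hanti.injective, hsurj⟩
  have he : ∀ x, ((e.symm x : G.topologicalClosure) : E × F).1 = x := fun x =>
    e.apply_symm_apply x
  refine ⟨LinearMap.mkContinuous ((LinearMap.snd ℂ E F).comp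
    (G.topologicalClosure.subtype.comp (e.symm : E →ₗ[ℂ] G.topologicalClosure))) C fun x => ?_,
    fun x => ?_⟩
  · have := hC' _ (e.symm x).2
    rwa [he] at this
  · have h1 : (x, ((e.symm x : G.topologicalClosure) : E × F).2) = (e.symm x : E × F) :=
      Prod.ext (he x).symm rfl
    change (x, ((e.symm x : G.topologicalClosure) : E × F).2) ∈ _
    rw [h1]
    exact (e.symm x).2

section Adjoint

variable {A : Type*} [NonUnitalCStarAlgebra A] [PartialOrder A] [StarOrderedRing A]
variable {E : Type*} [NormedAddCommGroup E] [NormedSpace ℂ E] [SMul A E] [CStarModule A E]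
  [CompleteSpace E]

/-- A bounded operator whose adjoint is defined on a dense set is adjointable. -/
theorem exists_isAdjPair_of_dense (T : E →L[ℂ] E) {D : Set E} (hD : Dense D)
    (h : ∀ z ∈ D, ∃ w, ∀ y, inner A (T y) z = inner A y w) : ∃ S, IsAdjPair A T S := by
  let G : Submodule ℂ (E × E) := adjointGraph A ((T : E →ₗ[ℂ] E).toPMap ⊤)
  have hG : ∀ p : E × E, p ∈ G ↔ ∀ y, inner A (T y) p.1 = inner A y p.2 := fun p =>
    ⟨fun hp y => hp ⟨y, trivial⟩, fun hp y => hp y⟩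
  obtain ⟨S, hS⟩ := exists_clm_of_bounded_relation G (hD.mono fun z hz => by
    obtain ⟨w, hw⟩ := h z hz
    exact ⟨(z, w), (hG _).2 hw, rfl⟩) ‖T‖ (by
      intro p hp
      -- Testing against `p.2` itself gives ‖p.2‖² ≤ ‖T‖ ‖p.1‖ ‖p.2‖.
      have h1 := (hG p).1 hp p.2
      rcases eq_or_lt_of_le (norm_nonneg p.2) with h0 | h0
      · rw [← h0]; positivity
      refine le_of_mul_le_mul_right ?_ h0
      calc ‖p.2‖ * ‖p.2‖ = ‖inner A p.2 p.2‖ := by rw [← sq, CStarModule.norm_sq_eq A]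
        _ = ‖inner A (T p.2) p.1‖ := by rw [h1]
        _ ≤ ‖T p.2‖ * ‖p.1‖ := CStarModule.norm_inner_le E
        _ ≤ ‖T‖ * ‖p.2‖ * ‖p.1‖ := by gcongr; exact T.le_opNorm _
        _ = ‖T‖ * ‖p.1‖ * ‖p.2‖ := by ring)
  have hcl : G.topologicalClosure = G :=
    IsClosed.submodule_topologicalClosure_eq (isClosed_adjointGraph _)
  rw [hcl] at hS
  exact ⟨S, fun x y => (hG _).1 (hS y) x⟩

end Adjoint

/-! ### Algebra of the bounded transform -/

section BoundedTransform

variable (A : Type*) [NonUnitalCStarAlgebra A] [PartialOrder A]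
variable {E : Type*} [NormedAddCommGroup E] [NormedSpace ℂ E] [SMul A E] [CStarModule A E]

/-- The algebraic relations between `Q = (1 + t⋆ t)^{-1/2}`, `F = F_t`, `Q' = (1 + t t⋆)^{-1/2}` and
`F' = F_t⋆`. -/
structure IsTransformData (Q F Q' F' : E →L[ℂ] E) : Prop where
  adj : IsAdjPair A F F'
  adj_left : IsAdjPair A Q Q
  adj_right : IsAdjPair A Q' Q'
  nonneg_left : ∀ x, 0 ≤ inner A x (Q x)
  nonneg_right : ∀ x, 0 ≤ inner A x (Q' x)
  add_left : ∀ x, Q (Q x) + F' (F x) = x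
  add_right : ∀ x, Q' (Q' x) + F (F' x) = x
  comm : ∀ x, F (Q x) = Q' (F x)
  comm' : ∀ x, F' (Q' x) = Q (F' x)

variable {A}

/-- Exchanging t and t⋆: each statement derived for t also serves for t⋆. -/
theorem IsTransformData.symm {Q F Q' F' : E →L[ℂ] E} (h : IsTransformData A Q F Q' F') :
    IsTransformData A Q' F' Q F where
  adj := h.adj.symm
  adj_left := h.adj_right
  adj_right := h.adj_left
  nonneg_left := h.nonneg_right
  nonneg_right := h.nonneg_left
  add_left := h.add_right
  add_right := h.add_left
  comm := h.comm'
  comm' := h.comm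

/-- Testing against the pairs (Qy, Fy) turns the adjoint relation into the single equation F'z =
Qz', which the algebraic relations solve. -/
theorem IsTransformData.mem_adjointGraph_iff {Q F Q' F' : E →L[ℂ] E}
    (h : IsTransformData A Q F Q' F') {t : E →ₗ.[ℂ] E}
    (ht : ∀ x u, (x, u) ∈ t.graph ↔ ∃ y, x = Q y ∧ u = F y) (z z' : E) :
    (z, z') ∈ adjointGraph A t ↔ ∃ y, z = Q' y ∧ z' = F' y := by
  have h1 : (z, z') ∈ adjointGraph A t ↔ F' z = Q z' := by
    rw [mem_adjointGraph]
    constructor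
    · intro hz
      refine inner_ext (A := A) fun y => ?_
      rw [← h.adj, ← h.adj_left]
      exact hz _ _ ((ht _ _).2 ⟨y, rfl, rfl⟩)
    · rintro hz x u hxu
      obtain ⟨y, rfl, rfl⟩ := (ht _ _).1 hxu
      rw [h.adj, h.adj_left, hz]
  rw [h1]
  constructor
  · intro hz
    -- The map y ↦ (Q'y, F'y) is isometric, and its adjoint recovers y.
    refine ⟨Q' z + F z', ?_, ?_⟩
    · rw [map_add, ← h.comm, ← hz, h.add_right]
    · rw [map_add, h.comm', hz, h.add_left]
  · rintro ⟨y, rfl, rfl⟩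
    exact h.comm' y

end BoundedTransform

section BoundedTransform

variable {A : Type*} [NonUnitalCStarAlgebra A] [PartialOrder A] [StarOrderedRing A]
variable {E : Type*} [NormedAddCommGroup E] [NormedSpace ℂ E] [SMul A E] [CStarModule A E]

theorem IsTransformData.mem_graph_padjoint_iff {Q F Q' F' : E →L[ℂ] E}
    (h : IsTransformData A Q F Q' F') {t : E →ₗ.[ℂ] E} (hd : Dense (t.domain : Set E))
    (ht : ∀ x u, (x, u) ∈ t.graph ↔ ∃ y, x = Q y ∧ u = F y) (z z' : E) :
    (z, z') ∈ (padjoint A t).graph ↔ ∃ y, z = Q' y ∧ z' = F' y := by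
  rw [graph_padjoint hd, h.mem_adjointGraph_iff ht]

theorem IsTransformData.mem_graph_one_add_iff {Q F Q' F' : E →L[ℂ] E}
    (h : IsTransformData A Q F Q' F') {t : E →ₗ.[ℂ] E} (hd : Dense (t.domain : Set E))
    (ht : ∀ x u, (x, u) ∈ t.graph ↔ ∃ y, x = Q y ∧ u = F y) (x w : E) :
    (x, w) ∈ (oneAddAdjointMul A t).graph ↔ x = Q (Q w) := by
  rw [mem_graph_one_add]
  constructor
  · rintro ⟨u, hxu, huw⟩
    obtain ⟨y, rfl, rfl⟩ := (ht _ _).1 hxu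
    obtain ⟨v, h1, h2⟩ := (h.mem_graph_padjoint_iff hd ht _ _).1 huw
    have h3 : w = Q y + F' v := by rw [← h2]; abel
    -- Qw = Q²y + QF'v = Q²y + F'Q'v = Q²y + F'Fy = y.
    rw [h3, map_add, ← h.comm', ← h1, h.add_left]
  · rintro rfl
    refine ⟨F (Q w), (ht _ _).2 ⟨Q w, rfl, rfl⟩, (h.mem_graph_padjoint_iff hd ht _ _).2
      ⟨F w, h.comm w, ?_⟩⟩
    rw [sub_eq_iff_eq_add', h.add_left]

/-- The inverse of `1 + t⋆ t` is the square of `Q`. -/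
theorem IsTransformData.mem_graph_inverse_iff {Q F Q' F' : E →L[ℂ] E}
    (h : IsTransformData A Q F Q' F') {t : E →ₗ.[ℂ] E} (hd : Dense (t.domain : Set E))
    (ht : ∀ x u, (x, u) ∈ t.graph ↔ ∃ y, x = Q y ∧ u = F y) (w x : E) :
    (w, x) ∈ (oneAddAdjointMul A t).inverse.graph ↔ x = Q (Q w) := by
  rw [← h.mem_graph_one_add_iff hd ht, LinearPMap.inverse_graph]
  · simp
  · rw [LinearMap.ker_eq_bot']
    intro y hy
    have h1 : ((y : E), (0 : E)) ∈ (oneAddAdjointMul A t).graph := by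
      rw [← hy]; exact LinearPMap.mem_graph _ y
    rw [h.mem_graph_one_add_iff hd ht] at h1
    exact Subtype.ext (by simpa using h1)

/-- Uniqueness of positive square roots singles out Q; this is the source of the uniqueness of the
bounded transform. -/
theorem IsTransformData.isInvSqrt_iff [CompleteSpace E] {Q F Q' F' : E →L[ℂ] E}
    (h : IsTransformData A Q F Q' F') {t : E →ₗ.[ℂ] E} (hd : Dense (t.domain : Set E))
    (ht : ∀ x u, (x, u) ∈ t.graph ↔ ∃ y, x = Q y ∧ u = F y) (P : Adjointable A E) :
    IsInvSqrt t P ↔ P.op = Q := by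
  have hgr : ∀ w x, (w, x) ∈ (pcomp P.toPMap P.toPMap).graph ↔ x = P.op (P.op w) := by
    intro w x
    simp only [mem_graph_pcomp, mem_graph_toPMap, exists_eq_left]
  constructor
  · rintro ⟨hP, hPP⟩
    have h1 := P.isAdjPair.eq_of_nonneg hP
    have h2 : IsAdjPair A P.op P.op := by
      have := P.isAdjPair; rwa [h1] at this
    refine eq_of_mul_self_eq h2 h.adj_left hP h.nonneg_left (ContinuousLinearMap.ext fun w => ?_)
    have h3 := (hgr w (P.op (P.op w))).2 rfl
    rw [hPP, h.mem_graph_inverse_iff hd ht] at h3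
    exact h3
  · rintro rfl
    refine ⟨h.nonneg_left, LinearPMap.eq_of_eq_graph (SetLike.ext ?_)⟩
    rintro ⟨w, x⟩
    rw [hgr, h.mem_graph_inverse_iff hd ht]

theorem IsTransformData.isBoundedTransform_iff [CompleteSpace E] {Q F Q' F' : E →L[ℂ] E}
    (h : IsTransformData A Q F Q' F') {t : E →ₗ.[ℂ] E} (hd : Dense (t.domain : Set E))
    (ht : ∀ x u, (x, u) ∈ t.graph ↔ ∃ y, x = Q y ∧ u = F y) (P : Adjointable A E) :
    IsBoundedTransform t P ↔ P.op = F := by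
  have key : ∀ R : Adjointable A E, R.op = Q → (P.toPMap = pcomp t R.toPMap ↔ P.op = F) := by
    rintro R rfl
    have hgr : ∀ x z, (x, z) ∈ (pcomp t R.toPMap).graph ↔ z = F x := by
      intro x z
      simp only [mem_graph_pcomp, mem_graph_toPMap, exists_eq_left]
      have h1 : (R.op x, F x) ∈ t.graph := (ht _ _).2 ⟨x, rfl, rfl⟩
      exact ⟨fun h2 => LinearPMap.mem_graph_snd_inj t h2 h1 rfl, fun h2 => h2 ▸ h1⟩
    constructor
    · intro h1
      refine ContinuousLinearMap.ext fun x => ?_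
      have h2 := (mem_graph_toPMap (T := P)).2 (rfl : P.op x = P.op x)
      rwa [h1, hgr] at h2
    · intro h1
      refine LinearPMap.eq_of_eq_graph (SetLike.ext ?_)
      rintro ⟨x, z⟩
      rw [hgr, mem_graph_toPMap, h1]
  constructor
  · rintro ⟨R, hR, hP⟩
    exact (key R ((h.isInvSqrt_iff hd ht R).1 hR)).1 hP
  · intro hP
    let R : Adjointable A E := ⟨Q, Q, h.adj_left⟩
    exact ⟨R, (h.isInvSqrt_iff hd ht R).2 rfl, (key R rfl).2 hP⟩

/-- `Q` fixes the kernel of `F`. -/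
theorem IsTransformData.apply_eq_self [CompleteSpace E] {Q F Q' F' : E →L[ℂ] E}
    (h : IsTransformData A Q F Q' F') {x : E} (hx : F x = 0) : Q x = x := by
  obtain ⟨M, -, -, hM⟩ := exists_inv_one_add h.adj_left h.nonneg_left
  have h1 : Q (Q x) = x := by simpa [hx] using h.add_left x
  -- Q²x = x factors as (1 + Q)(Qx - x) = 0, and 1 + Q is invertible.
  have h2 : (1 + Q) (Q x - x) = 0 := by
    simp [h1]
  have h3 := congrArg (fun T : E →L[ℂ] E => T (Q x - x)) hM
  simp only [mul_apply_eq_comp, h2, map_zero, one_apply_eq_self] at h3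
  exact sub_eq_zero.1 h3.symm

theorem IsTransformData.pker_eq [CompleteSpace E] {Q F Q' F' : E →L[ℂ] E}
    (h : IsTransformData A Q F Q' F') {t : E →ₗ.[ℂ] E}
    (ht : ∀ x u, (x, u) ∈ t.graph ↔ ∃ y, x = Q y ∧ u = F y) :
    pker t = LinearMap.ker (F : E →ₗ[ℂ] E) := by
  ext x
  rw [mem_pker, ht, LinearMap.mem_ker, ContinuousLinearMap.coe_coe]
  constructor
  · rintro ⟨y, rfl, hy⟩
    rw [h.apply_eq_self hy.symm, ← hy]
  · intro hx
    exact ⟨x, (h.apply_eq_self hx).symm, hx.symm⟩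

/-- The relations for `t⋆` follow from those for `t`, with `Q' = 1 - F (1 + Q)⁻¹ F⋆`. -/
theorem exists_isTransformData [CompleteSpace E] {Q F F' : E →L[ℂ] E} (hF : IsAdjPair A F F')
    (hQ : IsAdjPair A Q Q) (hpos : ∀ x, 0 ≤ inner A x (Q x))
    (hadd : Q * Q + F' * F = 1) : ∃ Q', IsTransformData A Q F Q' F' := by
  obtain ⟨M, hM, hM1, hM2⟩ := exists_inv_one_add hQ hpos
  have hFF : F' * F = (1 - Q) * (1 + Q) := by
    rw [eq_sub_of_add_eq' hadd]; noncomm_ring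
  have hFF' : F' * F = (1 + Q) * (1 - Q) := by
    rw [eq_sub_of_add_eq' hadd]; noncomm_ring
  -- Q' has to be (1 - FF')^{1/2}. The formula comes from 1 - (1 - s)^{1/2} = s / (1 + (1 -
  -- s)^{1/2}) and makes the commutation relations algebraic.
  let Q' : E →L[ℂ] E := 1 - F * M * F'
  have hQ' : IsAdjPair A Q' Q' := by
    have := IsAdjPair.one.sub ((hF.mul hM).mul hF.symm)
    rwa [← mul_assoc] at this
  have hcomm : F * Q = Q' * F := by
    calc F * Q = F - F * (1 * (1 - Q)) := by noncomm_ring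
      _ = F - F * M * (F' * F) := by rw [hFF', mul_assoc, ← mul_assoc M, hM2]
      _ = Q' * F := by simp only [Q', sub_mul, one_mul, mul_assoc]
  have hcomm' : F' * Q' = Q * F' := by
    calc F' * Q' = F' - F' * F * M * F' := by simp only [Q', mul_sub, mul_one, mul_assoc]
      _ = F' - (1 - Q) * ((1 + Q) * M) * F' := by rw [hFF]; simp only [mul_assoc]
      _ = Q * F' := by rw [hM1]; noncomm_ring
  have hsq : Q' * Q' + F * F' = 1 := by
    calc Q' * Q' + F * F' = Q' - Q' * F * M * F' + F * F' := by
          simp only [Q', mul_sub, mul_one, mul_assoc]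
      _ = 1 - F * ((1 + Q) * M) * F' + F * F' := by rw [← hcomm]; simp only [Q']; noncomm_ring
      _ = 1 := by rw [hM1]; simp
  have happ : ∀ {S T : E →L[ℂ] E}, S = T → ∀ x, S x = T x := fun h x => by rw [h]
  refine ⟨Q', hF, hQ, hQ', hpos, fun x => ?_, happ hadd, happ hsq, happ hcomm, happ hcomm'⟩
  -- Positivity follows from ⟨x, Q'x⟩ = ⟨Q'x, Q'x⟩ + ⟨y, Qy⟩ + ⟨Qy, Qy⟩ with y = (1 + Q)⁻¹F'x.
  set v := F' x with hv
  set y := M v with hy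
  have hvy : v = y + Q y := (happ hM1 v).symm
  have h1 : inner A x (Q' x) = inner A x x - inner A v y := by
    simp only [Q', sub_apply, mul_apply_eq_comp, one_apply_eq_self, CStarModule.inner_sub_right]
    rw [hF.inner_right]
  have h2 : inner A x x = inner A (Q' x) (Q' x) + inner A v v := by
    have h4 : Q' (Q' x) + F v = x := happ hsq x
    rw [hQ', hv, hF.symm, ← CStarModule.inner_add_right, ← hv, h4]
  have h3 : inner A v v = inner A v y + (inner A y (Q y) + inner A (Q y) (Q y)) := by
    conv_lhs => rw [hvy]
    conv_rhs => rw [hvy]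
    simp only [CStarModule.inner_add_left, CStarModule.inner_add_right, add_assoc]
  rw [h1, h2, h3]
  rw [add_sub_assoc, add_sub_cancel_left]
  exact add_nonneg CStarModule.inner_self_nonneg
    (add_nonneg (hpos y) CStarModule.inner_self_nonneg)

end BoundedTransform

/-! ### From a regular operator to its bounded transform -/

section Regular

variable {A : Type*} [NonUnitalCStarAlgebra A] [PartialOrder A]
variable {E : Type*} [NormedAddCommGroup E] [NormedSpace ℂ E] [SMul A E] [CStarModule A E]

variable (A) in
/-- Triples `(w, (x, u))` with `u = t x` and `w = x + t⋆ u`. -/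
def resolventRelation (t : E →ₗ.[ℂ] E) : Submodule ℂ (E × (E × E)) :=
  (t.graph.comap (LinearMap.snd ℂ E (E × E))) ⊓
    ((adjointGraph A t).comap
      (((LinearMap.snd ℂ E E).comp (LinearMap.snd ℂ E (E × E))).prod
        (LinearMap.fst ℂ E (E × E) - (LinearMap.fst ℂ E E).comp (LinearMap.snd ℂ E (E × E)))))

theorem mem_resolventRelation {t : E →ₗ.[ℂ] E} {w x u : E} :
    (w, (x, u)) ∈ resolventRelation A t ↔ (x, u) ∈ t.graph ∧ (u, w - x) ∈ adjointGraph A t :=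
  Iff.rfl

/-- The weak form of w = x + t⋆tx, from which the bounds, symmetry and positivity of the resolvent
all follow. -/
theorem inner_of_mem_resolventRelation {t : E →ₗ.[ℂ] E} {w x u x' u' : E}
    (h : (w, (x, u)) ∈ resolventRelation A t) (h' : (x', u') ∈ t.graph) :
    inner A x' w = inner A x' x + inner A u' u := by
  rw [mem_adjointGraph.1 (mem_resolventRelation.1 h).2 x' u' h', ← CStarModule.inner_add_right,
    add_sub_cancel]

variable [StarOrderedRing A]

/-- Keeping u = tx as a coordinate reduces closedness to that of t and of its adjoint relation. -/
theorem isClosed_resolventRelation {t : E →ₗ.[ℂ] E} (ht : t.IsClosed) :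
    IsClosed (resolventRelation A t : Set (E × (E × E))) :=
  (IsClosed.preimage continuous_snd ht).inter
    (IsClosed.preimage (f := fun p : E × (E × E) => (p.2.2, p.1 - p.2.1)) (by fun_prop)
      (isClosed_adjointGraph (A := A) t))

/-- The resolvent `R = (1 + t⋆ t)⁻¹` and `S = t R`. -/
theorem IsRegular.exists_resolvent [CompleteSpace E] {t : E →ₗ.[ℂ] E} (ht : IsRegular A t) :
    ∃ R S : E →L[ℂ] E, ∀ w, (w, (R w, S w)) ∈ resolventRelation A t := by
  obtain ⟨T, hT⟩ := exists_clm_of_bounded_relation (resolventRelation A t)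
    (ht.dense_range.mono (by
      rintro _ ⟨x, rfl⟩
      have h1 := LinearPMap.mem_graph (oneAddAdjointMul A t) x
      rw [mem_graph_one_add, graph_padjoint ht.dense_domain] at h1
      obtain ⟨u, h1, h2⟩ := h1
      exact ⟨(_, ((x : E), u)), ⟨h1, h2⟩, rfl⟩)) 1 (by
      rintro ⟨w, x, u⟩ h
      -- ⟨x, w⟩ = ⟨x, x⟩ + ⟨u, u⟩ bounds ‖x‖² and ‖u‖² by ‖x‖ ‖w‖, hence ‖x‖ and ‖u‖ by ‖w‖.
      have h1 := inner_of_mem_resolventRelation h (mem_resolventRelation.1 h).1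
      have h2 : ‖inner A x w‖ ≤ ‖x‖ * ‖w‖ := CStarModule.norm_inner_le E
      have hx : ‖x‖ ^ 2 ≤ ‖x‖ * ‖w‖ := by
        rw [CStarModule.norm_sq_eq A]
        refine le_trans (CStarAlgebra.norm_le_norm_of_nonneg_of_le
          CStarModule.inner_self_nonneg ?_) h2
        rw [h1]
        exact le_add_of_nonneg_right CStarModule.inner_self_nonneg
      have hu : ‖u‖ ^ 2 ≤ ‖x‖ * ‖w‖ := by
        rw [CStarModule.norm_sq_eq A]
        refine le_trans (CStarAlgebra.norm_le_norm_of_nonneg_of_le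
          CStarModule.inner_self_nonneg ?_) h2
        rw [h1]
        exact le_add_of_nonneg_left CStarModule.inner_self_nonneg
      have hxw : ‖x‖ ≤ ‖w‖ := by
        rcases eq_or_lt_of_le (norm_nonneg x) with h0 | h0
        · rw [← h0]; positivity
        · exact le_of_mul_le_mul_left (by rwa [← sq]) h0
      rw [one_mul]
      refine max_le hxw (le_of_sq_le_sq (hu.trans ?_) (norm_nonneg w))
      rw [sq]
      gcongr)
  rw [IsClosed.submodule_topologicalClosure_eq (isClosed_resolventRelation ht.isClosed)] at hT
  exact ⟨(ContinuousLinearMap.fst ℂ E E).comp T, (ContinuousLinearMap.snd ℂ E E).comp T, hT⟩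

/-- A regular operator is given by its bounded transform: its graph is `{(Q y, F y)}`. -/
theorem IsRegular.exists_transform [CompleteSpace E] {t : E →ₗ.[ℂ] E} (ht : IsRegular A t) :
    ∃ Q F Q' F' : E →L[ℂ] E, IsTransformData A Q F Q' F' ∧
      ∀ x u, (x, u) ∈ t.graph ↔ ∃ y, x = Q y ∧ u = F y := by
  obtain ⟨R, S, hRS⟩ := ht.exists_resolvent
  have hg : ∀ w, (R w, S w) ∈ t.graph := fun w => (mem_resolventRelation.1 (hRS w)).1
  have hinner : ∀ w w', inner A (R w') w = inner A (R w') (R w) + inner A (S w') (S w) :=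
    fun w w' => inner_of_mem_resolventRelation (hRS w) (hg w')
  have hR : IsAdjPair A R R := fun w' w => by
    rw [← CStarModule.star_inner (R w), hinner w w', hinner w' w, star_add, CStarModule.star_inner,
      CStarModule.star_inner]
  have hRpos : ∀ w, 0 ≤ inner A w (R w) := fun w => by
    rw [← hR, hinner]
    exact add_nonneg CStarModule.inner_self_nonneg CStarModule.inner_self_nonneg
  have hdt := ht.dense_adjoint_domain
  have hadj : ∀ z ∈ ((padjoint A t).domain : Set E), ∃ z', (z, z') ∈ adjointGraph A t := by
    intro z hz
    rw [← graph_padjoint ht.dense_domain]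
    exact LinearPMap.mem_domain_iff.1 hz
  have hadj' : ∀ {z z'}, (z, z') ∈ adjointGraph A t → ∀ x u, (x, u) ∈ t.graph →
      inner A u z = inner A x z' := fun h => mem_adjointGraph.1 h
  obtain ⟨S', hS'⟩ := exists_isAdjPair_of_dense (A := A) S hdt fun z hz => by
    obtain ⟨z', hz'⟩ := hadj z hz
    exact ⟨R z', fun y => by rw [hadj' hz' _ _ (hg y), hR]⟩
  have hdecomp : ∀ x u, (x, u) ∈ t.graph → x = R x + S' u := fun x u hxu => by
    refine inner_ext_left (A := A) fun w => ?_
    rw [CStarModule.inner_add_left, hR, hS'.symm]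
    exact inner_of_mem_resolventRelation (hRS w) hxu
  -- In x = Rx + S'u the second term is a limit of vectors S'v with v ∈ Dom t⋆, and S'v = R(t⋆v).
  -- Thus Dom t lies in the closure of the range of R.
  have hdense : DenseRange R := by
    refine dense_closure.1 (ht.dense_domain.mono fun x hx => ?_)
    obtain ⟨u, hu⟩ := LinearPMap.mem_domain_iff.1 hx
    have hcl : ∀ z, S' z ∈ closure (Set.range R) := fun z => by
      have h1 : S' z ∈ closure (S' '' ((padjoint A t).domain : Set E)) :=
        image_closure_subset_closure_image S'.continuous ⟨z, hdt z, rfl⟩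
      refine closure_mono ?_ h1
      rintro _ ⟨v, hv, rfl⟩
      obtain ⟨v', hv'⟩ := hadj v hv
      refine ⟨v', inner_ext (A := A) fun y => ?_⟩
      rw [← hS', hadj' hv' _ _ (hg y), hR]
    rw [hdecomp x u hu]
    have h2 : R x ∈ (LinearMap.range (R : E →ₗ[ℂ] E)).topologicalClosure :=
      subset_closure ⟨x, rfl⟩
    exact Submodule.add_mem (LinearMap.range (R : E →ₗ[ℂ] E)).topologicalClosure h2
      (by
        change S' u ∈ closure ((LinearMap.range (R : E →ₗ[ℂ] E) : Submodule ℂ E) : Set E)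
        rw [LinearMap.coe_range]
        exact hcl u)
  obtain ⟨Q, hQ, hQpos, hQQ⟩ := exists_sqrt hR hRpos
  have hQQ' : ∀ w, Q (Q w) = R w := fun w => by rw [← hQQ]; rfl
  have hdenseQ : DenseRange Q := Dense.mono (by
    rintro _ ⟨w, rfl⟩
    exact ⟨Q w, hQQ' w⟩) hdense
  -- F extends Qw ↦ Sw, a contraction because ⟨Qw, Qw⟩ = ⟨Rw, Rw⟩ + ⟨Sw, Sw⟩. Closedness of t keeps
  -- the limits in its graph.
  obtain ⟨F, hF⟩ : ∃ F : E →L[ℂ] E, ∀ y, (Q y, F y) ∈ t.graph := by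
    obtain ⟨F, hF⟩ := exists_clm_of_bounded_relation (LinearMap.range (Q.prod S : E →ₗ[ℂ] E × E))
      (hdenseQ.mono (by
        rintro _ ⟨w, rfl⟩
        exact ⟨(Q w, S w), ⟨w, rfl⟩, rfl⟩)) 1 (by
      rintro _ ⟨w, rfl⟩
      rw [one_mul]
      refine norm_le_norm_of_inner_le (A := A) ?_
      change inner A (S w) (S w) ≤ inner A (Q w) (Q w)
      rw [hQ, hQQ', ← hR, hinner]
      exact le_add_of_nonneg_left CStarModule.inner_self_nonneg)
    refine ⟨F, fun y => ?_⟩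
    have hcl : IsClosed {p : E × E | (Q p.1, p.2) ∈ t.graph} :=
      IsClosed.preimage (f := fun p : E × E => (Q p.1, p.2)) (by fun_prop) ht.isClosed
    refine closure_minimal ?_ hcl (hF y)
    rintro _ ⟨w, rfl⟩
    change (Q (Q w), S w) ∈ t.graph
    rw [hQQ']
    exact hg w
  obtain ⟨F', hF'⟩ := exists_isAdjPair_of_dense (A := A) F hdt fun z hz => by
    obtain ⟨z', hz'⟩ := hadj z hz
    exact ⟨Q z', fun y => by rw [hadj' hz' _ _ (hF y), hQ]⟩
  have hFQ : ∀ w, F (Q w) = S w := fun w =>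
    LinearPMap.mem_graph_snd_inj t (hF (Q w)) (hg w) (hQQ' w)
  have hS'F' : S' = Q * F' := by
    have h1 : S = F * Q := ContinuousLinearMap.ext fun w => (hFQ w).symm
    exact hS'.unique (h1 ▸ hF'.mul hQ)
  have hadd : Q * Q + F' * F = 1 := by
    refine ContinuousLinearMap.ext fun y => ?_
    refine congrFun (Continuous.ext_on hdenseQ (Q * Q + F' * F).continuous
      (1 : E →L[ℂ] E).continuous ?_) y
    rintro _ ⟨w, rfl⟩
    refine inner_ext_of_dense (A := A) hdenseQ ?_
    rintro _ ⟨w', rfl⟩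
    simp only [add_apply, mul_apply_eq_comp, one_apply_eq_self, CStarModule.inner_add_right]
    rw [← hF', hFQ, hFQ, ← hQ, hQQ', hQQ', ← hinner, ← hQQ', hQ]
  obtain ⟨Q', hQ'⟩ := exists_isTransformData hF' hQ hQpos hadd
  refine ⟨Q, F, Q', F', hQ', fun x u => ⟨fun hxu => ?_, ?_⟩⟩
  -- Since S' = QF', the decomposition x = Rx + S'u exhibits x in the range of Q.
  · have h1 : x = Q (Q x + F' u) := by
      conv_lhs => rw [hdecomp x u hxu, hS'F', ← hQQ']
      simp
    exact ⟨Q x + F' u, h1, LinearPMap.mem_graph_snd_inj t hxu (hF _) h1⟩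
  · rintro ⟨y, rfl, rfl⟩
    exact hF y

end Regular

/-! ### Module-compact operators and Fredholmness of the transform -/

section Fredholm

variable {A : Type*} [NonUnitalCStarAlgebra A] [PartialOrder A] [StarOrderedRing A]
variable {E : Type*} [NormedAddCommGroup E] [NormedSpace ℂ E] [SMul A E] [CStarModule A E]

theorem theta_apply (x y z : E) : theta A x y z = inner A x z • y := rfl

/-- A closed linear condition on operators that holds for all `Θ_{x,y}` holds on `K(E)`. -/
theorem map_mem_of_mem_moduleCompacts {Y : Type*} [AddCommGroup Y] [Module ℂ Y]
    [TopologicalSpace Y] (L : (E →L[ℂ] E) →L[ℂ] Y) {V : Submodule ℂ Y} (hV : IsClosed (V : Set Y))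
    (h : ∀ x y : E, L (theta A x y) ∈ V) {k : E →L[ℂ] E} (hk : k ∈ moduleCompacts A E) :
    L k ∈ V := by
  have hle : moduleCompacts A E ≤ V.comap L.toLinearMap := by
    refine Submodule.topologicalClosure_minimal _ (Submodule.span_le.2 ?_)
      (IsClosed.preimage L.continuous hV)
    rintro _ ⟨x, y, rfl⟩
    exact h x y
  exact hle hk

theorem theta_mem_moduleCompacts (x y : E) : theta A x y ∈ moduleCompacts A E :=
  Submodule.le_topologicalClosure _ (Submodule.subset_span ⟨x, y, rfl⟩)

theorem IsAdjPair.mul_mem_moduleCompacts {T S : E →L[ℂ] E} (h : IsAdjPair A T S) {k : E →L[ℂ] E}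
    (hk : k ∈ moduleCompacts A E) : T * k ∈ moduleCompacts A E := by
  refine map_mem_of_mem_moduleCompacts (ContinuousLinearMap.mul ℂ (E →L[ℂ] E) T)
    (Submodule.isClosed_topologicalClosure _) (fun x y => ?_) hk
  have : T * theta A x y = theta A x (T y) :=
    ContinuousLinearMap.ext fun z => h.map_act _ _
  change T * theta A x y ∈ moduleCompacts A E
  rw [this]
  exact theta_mem_moduleCompacts _ _

theorem IsAdjPair.mem_moduleCompacts_mul {T S : E →L[ℂ] E} (h : IsAdjPair A T S) {k : E →L[ℂ] E}
    (hk : k ∈ moduleCompacts A E) : k * T ∈ moduleCompacts A E := by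
  refine map_mem_of_mem_moduleCompacts ((ContinuousLinearMap.mul ℂ (E →L[ℂ] E)).flip T)
    (Submodule.isClosed_topologicalClosure _) (fun x y => ?_) hk
  have : theta A x y * T = theta A (S x) y :=
    ContinuousLinearMap.ext fun z => by
      rw [mul_apply_eq_comp, theta_apply, theta_apply, h.inner_right]
  change theta A x y * T ∈ moduleCompacts A E
  rw [this]
  exact theta_mem_moduleCompacts _ _

/-- `K(E)` is closed under adjoints. -/
theorem IsAdjPair.conj_mem_moduleCompacts {k k' : E →L[ℂ] E} (h : IsAdjPair A k k')
    (hk : k ∈ moduleCompacts A E) : k' ∈ moduleCompacts A E := by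
  have hspan : ∀ T ∈ Submodule.span ℂ {T : E →L[ℂ] E | ∃ x y : E, T = theta A x y},
      ∃ T' ∈ Submodule.span ℂ {T : E →L[ℂ] E | ∃ x y : E, T = theta A x y}, IsAdjPair A T T' := by
    intro T hT
    induction hT using Submodule.span_induction with
    | mem T hT =>
      obtain ⟨x, y, rfl⟩ := hT
      exact ⟨theta A y x, Submodule.subset_span ⟨y, x, rfl⟩, fun z w => by simp [theta_apply]⟩
    | zero => exact ⟨0, Submodule.zero_mem _, fun z w => by simp⟩
    | add T S _ _ hT hS =>
      obtain ⟨T', hT', h1⟩ := hT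
      obtain ⟨S', hS', h2⟩ := hS
      exact ⟨T' + S', Submodule.add_mem _ hT' hS', h1.add h2⟩
    | smul c T _ hT =>
      obtain ⟨T', hT', h1⟩ := hT
      exact ⟨star c • T', Submodule.smul_mem _ _ hT', h1.smul c⟩
  refine Metric.mem_closure_iff.2 fun ε hε => ?_
  obtain ⟨T, hT, hkT⟩ := Metric.mem_closure_iff.1 hk ε hε
  obtain ⟨T', hT', hTT'⟩ := hspan T hT
  refine ⟨T', hT', lt_of_le_of_lt ?_ hkT⟩
  rw [dist_eq_norm, dist_eq_norm]
  exact (h.sub hTT').symm.norm_le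

/-- The bounded transform of a Fredholm operator is Fredholm. -/
theorem IsTransformData.isFredholm {Q F Q' F' : E →L[ℂ] E} (h : IsTransformData A Q F Q' F')
    {t : E →ₗ.[ℂ] E} (htc : t.IsClosed)
    (ht : ∀ x u, (x, u) ∈ t.graph ↔ ∃ y, x = Q y ∧ u = F y) (htF : IsFredholm A t) :
    Adjointable.IsFredholm (⟨F, F', h.adj⟩ : Adjointable A E) := by
  obtain ⟨⟨G, hGc, S, hS, hSK⟩, G', hGc', S', hS', hSK'⟩ := htF
  constructor
  · have h1 : G.op * F = S.op * Q := ContinuousLinearMap.ext fun y => by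
      have h2 : (Q y, G.op (F y)) ∈ (pcomp G.toPMap t).closure.graph := by
        refine LinearPMap.le_graph_of_le (LinearPMap.le_closure _) ?_
        exact mem_graph_pcomp.2 ⟨F y, (ht _ _).2 ⟨y, rfl, rfl⟩, mem_graph_toPMap.2 rfl⟩
      rw [hS, mem_graph_toPMap] at h2
      exact h2
    have hadd : Q * Q + F' * F = 1 := ContinuousLinearMap.ext h.add_left
    -- F'F = 1 - Q² misses the identity by Q², and QGF = QSQ restores it modulo K(E).
    refine ⟨⟨F' + Q * G.op, F + G.adj * Q, h.adj.symm.add (h.adj_left.mul G.isAdjPair)⟩, ?_⟩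
    have h3 : (F' + Q * G.op) * F - 1 = Q * (S.op - 1) * Q := by
      rw [add_mul, mul_assoc, h1, eq_sub_of_add_eq' hadd]
      simp only [mul_sub, sub_mul, mul_one, mul_assoc]
      abel
    change (F' + Q * G.op) * F - 1 ∈ _
    rw [h3]
    exact h.adj_left.mem_moduleCompacts_mul (h.adj_left.mul_mem_moduleCompacts hSK)
  -- With the bounded factor on the right the composition is already closed, so S' equals tG' itself
  -- and G' maps into Dom t.
  · have hcl : (pcomp t G'.toPMap).IsClosed := by
      have : ((pcomp t G'.toPMap).graph : Set (E × E)) =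
          (fun p : E × E => (G'.op p.1, p.2)) ⁻¹' (t.graph : Set (E × E)) := by
        ext ⟨x, z⟩
        simp only [SetLike.mem_coe, mem_graph_pcomp, mem_graph_toPMap, exists_eq_left,
          Set.mem_preimage]
      rw [LinearPMap.IsClosed, this]
      exact IsClosed.preimage (by fun_prop) htc
    have heq : pcomp t G'.toPMap = S'.toPMap := by
      rw [← hS']
      refine LinearPMap.eq_of_eq_graph ?_
      rw [← hGc'.graph_closure_eq_closure_graph]
      exact (IsClosed.submodule_topologicalClosure_eq hcl).symm
    refine ⟨⟨Q * G'.op + F' * S'.op, G'.adj * Q + S'.adj * F,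
      (h.adj_left.mul G'.isAdjPair).add (h.adj.symm.mul S'.isAdjPair)⟩, ?_⟩
    -- The pair (G'x, S'x) lies in the graph of t, hence equals (Qy, Fy) with y = QG'x + F'S'x.
    have h1 : F * (Q * G'.op + F' * S'.op) = S'.op := ContinuousLinearMap.ext fun x => by
      have h2 : (x, S'.op x) ∈ (pcomp t G'.toPMap).graph := by
        rw [heq]; exact mem_graph_toPMap.2 rfl
      obtain ⟨_, h3, h4⟩ := mem_graph_pcomp.1 h2
      rw [mem_graph_toPMap] at h3
      subst h3
      obtain ⟨y, hy1, hy2⟩ := (ht _ _).1 h4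
      simp only [mul_apply_eq_comp, add_apply]
      rw [hy1, hy2, h.add_left]
    change F * (Q * G'.op + F' * S'.op) - 1 ∈ _
    rw [h1]
    exact hSK'

end Fredholm

/-! ### Module laws of the action, recovered from the inner product -/

section Act

variable {A : Type*} [NonUnitalCStarAlgebra A] [PartialOrder A]
variable {E : Type*} [NormedAddCommGroup E] [NormedSpace ℂ E] [SMul A E] [CStarModule A E]

theorem act_add (a : A) (x y : E) : a • (x + y) = a • x + a • y :=
  inner_ext (A := A) fun z => by simp [mul_add]

theorem act_smul (a : A) (c : ℂ) (x : E) : a • (c • x) = c • (a • x) :=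
  inner_ext (A := A) fun z => by simp [mul_smul_comm]

theorem smul_act (c : ℂ) (a : A) (x : E) : (c • a) • x = c • (a • x) :=
  inner_ext (A := A) fun z => by simp [smul_mul_assoc]

theorem mul_act (a b : A) (x : E) : (a * b) • x = a • (b • x) :=
  inner_ext (A := A) fun z => by simp [mul_assoc]

theorem sum_act {ι : Type*} (s : Finset ι) (a : ι → A) (x : E) :
    (∑ i ∈ s, a i) • x = ∑ i ∈ s, a i • x :=
  inner_ext (A := A) fun z => by simp [Finset.sum_mul]

/-- The action of an element of `A` as a bounded operator. -/
noncomputable def actL (a : A) : E →L[ℂ] E :=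
  LinearMap.mkContinuous
    { toFun := fun x => a • x
      map_add' := act_add a
      map_smul' := fun c x => act_smul a c x } ‖a‖ fun x => norm_act_le a x

theorem actL_apply (a : A) (x : E) : actL a x = a • x := rfl

/-- A vector is fixed by its inner square if the latter is a projection. -/
theorem inner_self_act_self {x : E} (h : IsIdempotentElem (inner A x x)) :
    inner A x x • x = x := by
  rw [← sub_eq_zero, ← CStarModule.inner_self (A := A)]
  simp [h.eq]

end Act

/-! ### Rank one operators and finite-rank approximation -/

section CompactOperators

variable {H : Type*} [NormedAddCommGroup H] [InnerProductSpace ℂ H] [CompleteSpace H]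

/-- A compact operator as a bounded operator. -/
def CompactOp.toCLM (a : CompactOp H) : H →L[ℂ] H := Subtype.val a

namespace CompactOp

theorem ext {a b : CompactOp H} (h : ∀ x, a.toCLM x = b.toCLM x) : a = b :=
  Subtype.ext (ContinuousLinearMap.ext h)

theorem toCLM_mul (a b : CompactOp H) : (a * b).toCLM = a.toCLM * b.toCLM := rfl
theorem toCLM_add (a b : CompactOp H) : (a + b).toCLM = a.toCLM + b.toCLM := rfl
theorem toCLM_sub (a b : CompactOp H) : (a - b).toCLM = a.toCLM - b.toCLM := rfl
theorem toCLM_zero : (0 : CompactOp H).toCLM = 0 := rfl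
theorem toCLM_smul (c : ℂ) (a : CompactOp H) : (c • a).toCLM = c • a.toCLM := rfl
theorem toCLM_star (a : CompactOp H) : (star a).toCLM = star a.toCLM := rfl
theorem norm_toCLM (a : CompactOp H) : ‖a.toCLM‖ = ‖a‖ := rfl

theorem toCLM_sum {ι : Type*} (s : Finset ι) (a : ι → CompactOp H) :
    (∑ i ∈ s, a i).toCLM = ∑ i ∈ s, (a i).toCLM :=
  map_sum (AddMonoidHom.mk' (toCLM (H := H)) toCLM_add) a s

theorem isCompactOperator (a : CompactOp H) : IsCompactOperator a.toCLM := a.2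

theorem inner_star_left (a : CompactOp H) (x y : H) :
    inner ℂ ((star a).toCLM x) y = inner ℂ x (a.toCLM y) :=
  ContinuousLinearMap.adjoint_inner_left a.toCLM y x

end CompactOp

/-- A bounded operator with values in a finite-dimensional subspace is compact. -/
theorem isCompactOperator_of_forall_mem {V W : Type*} [NormedAddCommGroup V] [NormedSpace ℂ V]
    [NormedAddCommGroup W] [NormedSpace ℂ W] (T : V →L[ℂ] W) (U : Submodule ℂ W)
    [FiniteDimensional ℂ U] (h : ∀ x, T x ∈ U) : IsCompactOperator T := by
  have : ProperSpace U := FiniteDimensional.proper ℂ U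
  have h1 : IsCompactOperator (T.codRestrict U h) :=
    isCompactOperator_of_locallyCompactSpace_dom _
  exact h1.clm_comp U.subtypeL

/-- The rank one operator `ζ ↦ ⟨η, ζ⟩ ξ`. -/
noncomputable def ketBra (ξ η : H) : CompactOp H :=
  ⟨InnerProductSpace.rankOne ℂ ξ η,
    isCompactOperator_of_forall_mem _ (Submodule.span ℂ {ξ}) fun x => by
      rw [InnerProductSpace.rankOne_apply]
      exact Submodule.smul_mem _ _ (Submodule.mem_span_singleton_self ξ)⟩

theorem toCLM_ketBra (ξ η : H) : (ketBra ξ η).toCLM = InnerProductSpace.rankOne ℂ ξ η := rfl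

theorem ketBra_apply (ξ η x : H) : (ketBra ξ η).toCLM x = inner ℂ η x • ξ := rfl

theorem star_ketBra (ξ η : H) : star (ketBra ξ η) = ketBra η ξ :=
  CompactOp.ext fun x => by
    rw [CompactOp.toCLM_star, toCLM_ketBra, ContinuousLinearMap.star_eq_adjoint,
      InnerProductSpace.adjoint_rankOne]
    rfl

/-- The middle factor collapses to a scalar, which is what makes corners complex inner product
spaces. -/
theorem ketBra_mul_mul_ketBra (ξ η ζ θ : H) (a : CompactOp H) :
    ketBra ξ η * a * ketBra ζ θ = inner ℂ η (a.toCLM ζ) • ketBra ξ θ :=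
  CompactOp.ext fun x => by
    simp only [CompactOp.toCLM_mul, CompactOp.toCLM_smul, mul_apply_eq_comp, ketBra_apply, map_smul,
      smul_apply, smul_smul]
    rw [mul_comm]

theorem ketBra_mul_ketBra (ξ η ζ θ : H) :
    ketBra ξ η * ketBra ζ θ = inner ℂ η ζ • ketBra ξ θ :=
  CompactOp.ext fun x => by
    simp only [CompactOp.toCLM_mul, CompactOp.toCLM_smul, mul_apply_eq_comp, ketBra_apply,
      smul_apply, inner_smul_right, smul_smul]
    rw [mul_comm]

theorem ketBra_mul_ketBra_of_norm_eq_one {η : H} (hη : ‖η‖ = 1) (ξ θ : H) :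
    ketBra ξ η * ketBra η θ = ketBra ξ θ := by
  rw [ketBra_mul_ketBra, inner_self_eq_norm_sq_to_K, hη]; simp

theorem isMinimalProjection_ketBra {ξ : H} (hξ : ‖ξ‖ = 1) :
    IsMinimalProjection (ketBra ξ ξ) := by
  refine ⟨⟨ketBra_mul_ketBra_of_norm_eq_one hξ ξ ξ, star_ketBra ξ ξ⟩, fun h => ?_,
    fun a => ⟨_, ketBra_mul_mul_ketBra ξ ξ ξ ξ a⟩⟩
  have h1 := congrArg (fun a : CompactOp H => a.toCLM ξ) h
  simp only [ketBra_apply, inner_self_eq_norm_sq_to_K, hξ, CompactOp.toCLM_zero] at h1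
  have : ξ = 0 := by simpa using h1
  simp [this] at hξ

/-- The minimal projections of `𝒦(H)` have rank one. -/
theorem IsMinimalProjection.exists_eq_ketBra {p : CompactOp H} (hp : IsMinimalProjection p) :
    ∃ η : H, ‖η‖ = 1 ∧ p = ketBra η η := by
  obtain ⟨⟨hpp, hps⟩, hp0, hmin⟩ := hp
  obtain ⟨x, hx⟩ : ∃ x, p.toCLM x ≠ 0 := by
    by_contra! h
    exact hp0 (CompactOp.ext h)
  set y := p.toCLM x with hy
  have hpy : p.toCLM y = y := congrArg (fun a : CompactOp H => a.toCLM x) hpp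
  set η : H := ((‖y‖⁻¹ : ℝ) : ℂ) • y with hη
  have hη1 : ‖η‖ = 1 := by
    rw [hη, norm_smul]
    simp [norm_ne_zero_iff.2 hx]
  have hpη : p.toCLM η = η := by rw [hη, map_smul, hpy]
  -- Minimality is applied to the projection onto a unit vector in the range of p: compression by p
  -- fixes it, so it is a multiple of p.
  obtain ⟨c, hc⟩ := hmin (ketBra η η)
  have hk : p * ketBra η η * p = ketBra η η := CompactOp.ext fun z => by
    simp only [CompactOp.toCLM_mul, mul_apply_eq_comp, ketBra_apply, map_smul, hpη]
    rw [← CompactOp.inner_star_left, hps.star_eq, hpη]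
  rw [hk] at hc
  have hc1 : c = 1 := by
    have h1 := congrArg (fun a : CompactOp H => a.toCLM η) hc
    simp only [ketBra_apply, inner_self_eq_norm_sq_to_K, hη1, CompactOp.toCLM_smul,
      smul_apply, hpη] at h1
    have hη0 : η ≠ 0 := by rw [← norm_ne_zero_iff, hη1]; exact one_ne_zero
    have h2 : (1 - c) • η = 0 := by
      rw [sub_smul, ← h1]; simp
    exact (sub_eq_zero.1 ((smul_eq_zero.1 h2).resolve_right hη0)).symm
  exact ⟨η, hη1, by rw [hc, hc1, one_smul]⟩

/-- A compact operator is approximated by its compressions to finite-dimensional subspaces. -/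
theorem CompactOp.exists_finiteDimensional (a : CompactOp H) {ε : ℝ} (hε : 0 < ε) :
    ∃ (W : Submodule ℂ H) (_ : FiniteDimensional ℂ W),
      ‖(1 - W.starProjection) * a.toCLM‖ ≤ ε := by
  have hc := (a.isCompactOperator.isCompact_closure_image_closedBall
    (f := (a.toCLM : H →ₗ[ℂ] H)) 1).totallyBounded.subset subset_closure
  obtain ⟨s, hs, hcov⟩ := Metric.totallyBounded_iff.1 hc ε hε
  -- W is spanned by a finite ε-net of the image of the unit ball; 1 - P kills the net and is
  -- contractive.
  have hfin : FiniteDimensional ℂ (Submodule.span ℂ s) := FiniteDimensional.span_of_finite ℂ hs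
  refine ⟨Submodule.span ℂ s, hfin, ?_⟩
  set P := (Submodule.span ℂ s).starProjection with hP
  refine ContinuousLinearMap.opNorm_le_of_unit_norm hε.le fun x hx => ?_
  obtain ⟨y, hy, hxy⟩ := Set.mem_iUnion₂.1 (hcov ⟨x, by simp [hx], rfl⟩)
  have h1 : P y = y :=
    Submodule.starProjection_eq_self_iff.2 (Submodule.subset_span hy)
  have h2 : ((1 - P) * a.toCLM) x = (1 - P) (a.toCLM x - y) := by
    simp [h1]
  have h3 : ‖1 - P‖ ≤ 1 := by
    have : 1 - P = ((Submodule.span ℂ s)ᗮ).starProjection := by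
      rw [Submodule.starProjection_orthogonal']
    rw [this]
    exact Submodule.starProjection_norm_le _
  rw [h2]
  rw [Metric.mem_ball, dist_eq_norm] at hxy
  calc ‖(1 - P) (a.toCLM x - y)‖ ≤ 1 * ‖a.toCLM x - y‖ :=
        ContinuousLinearMap.le_of_opNorm_le _ h3 _
    _ ≤ ε := by rw [one_mul]; exact hxy.le

variable {E : Type*} [NormedAddCommGroup E] [NormedSpace ℂ E]
  [SMul (CompactOp H) E] [CStarModule (CompactOp H) E]

/-- Every vector of a Hilbert `𝒦(H)`-module is approximated by its compressions to rank one
projections. -/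
theorem mem_closure_span_ketBra (x : E) :
    x ∈ (Submodule.span ℂ (Set.range fun ζ : H => ketBra ζ ζ • x)).topologicalClosure := by
  change x ∈ closure _
  rw [Metric.mem_closure_iff]
  intro ε hε
  -- ‖x - px‖² = ‖(1 - P)⟨x, x⟩(1 - P)‖ for the projection p onto W; the factor 1/2 yields the
  -- strict inequality.
  obtain ⟨W, _, hW⟩ := (inner (CompactOp H) x x).exists_finiteDimensional
    (ε := ε ^ 2 / 2) (by positivity)
  let b := stdOrthonormalBasis ℂ W
  let p : CompactOp H := ∑ i, ketBra (b i : H) (b i : H)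
  have hp : p.toCLM = W.starProjection := by
    rw [b.starProjection_eq_sum_rankOne, CompactOp.toCLM_sum]
    rfl
  have hps : star p = p := by simp only [p, star_sum, star_ketBra]
  refine ⟨p • x, ?_, ?_⟩
  · rw [sum_act]
    exact Submodule.sum_mem _ fun i _ => Submodule.subset_span ⟨_, rfl⟩
  have h1 : ‖x - p • x‖ ^ 2 ≤ ε ^ 2 / 2 := by
    rw [CStarModule.norm_sq_eq (CompactOp H), ← CompactOp.norm_toCLM]
    have h2 : (inner (CompactOp H) (x - p • x) (x - p • x)).toCLM =
        (1 - W.starProjection) * (inner (CompactOp H) x x).toCLM * (1 - W.starProjection) := by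
      simp only [CStarModule.inner_sub_left, CStarModule.inner_sub_right,
        CStarModule.inner_op_smul_left, CStarModule.inner_op_smul_right, hps,
        CompactOp.toCLM_sub, CompactOp.toCLM_mul, hp]
      noncomm_ring
    have h3 : ‖1 - W.starProjection‖ ≤ 1 := by
      rw [← Submodule.starProjection_orthogonal']
      exact Submodule.starProjection_norm_le _
    rw [h2]
    calc _ ≤ ‖(1 - W.starProjection) * (inner (CompactOp H) x x).toCLM‖ *
          ‖1 - W.starProjection‖ := norm_mul_le _ _
      _ ≤ ε ^ 2 / 2 * 1 := by gcongr
      _ = _ := mul_one _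
  rw [dist_eq_norm]
  refine lt_of_pow_lt_pow_left₀ 2 hε.le (lt_of_le_of_lt h1 ?_)
  have : 0 < ε ^ 2 := by positivity
  linarith

end CompactOperators

/-! ### Corners and orthonormal dimension -/

section Dimension

variable {H : Type*} [NormedAddCommGroup H] [InnerProductSpace ℂ H] [CompleteSpace H]
variable {E : Type*} [NormedAddCommGroup E] [NormedSpace ℂ E]
  [SMul (CompactOp H) E] [CStarModule (CompactOp H) E]

/-- The corner `e X` of a submodule `X`, for the rank one projection `e` onto the span of `ξ`. -/
def corner (ξ : H) (X : Submodule ℂ E) : Submodule ℂ E where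
  carrier := {x | x ∈ X ∧ ketBra ξ ξ • x = x}
  add_mem' := fun ⟨hx, hx'⟩ ⟨hy, hy'⟩ => ⟨X.add_mem hx hy, by rw [act_add, hx', hy']⟩
  zero_mem' := ⟨X.zero_mem, (actL (ketBra ξ ξ)).map_zero⟩
  smul_mem' c _ := fun ⟨hx, hx'⟩ => ⟨X.smul_mem c hx, by rw [act_smul, hx']⟩

theorem mem_corner {ξ : H} {X : Submodule ℂ E} {x : E} :
    x ∈ corner ξ X ↔ x ∈ X ∧ ketBra ξ ξ • x = x := Iff.rfl

theorem isClosed_corner (ξ : H) {X : Submodule ℂ E} (hX : IsClosed (X : Set E)) :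
    IsClosed (corner ξ X : Set E) :=
  hX.inter (isClosed_eq (actL (ketBra ξ ξ) : E →L[ℂ] E).continuous continuous_id)

theorem theta_add_left (x x' y : E) :
    theta (CompactOp H) (x + x') y = theta (CompactOp H) x y + theta (CompactOp H) x' y :=
  ContinuousLinearMap.ext fun z => inner_ext (A := CompactOp H) fun w => by
    simp [theta_apply, add_mul]

theorem theta_smul_left (c : ℂ) (x y : E) :
    theta (CompactOp H) (c • x) y = star c • theta (CompactOp H) x y :=
  ContinuousLinearMap.ext fun z => inner_ext (A := CompactOp H) fun w => by
    simp [theta_apply, smul_mul_assoc]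

theorem continuous_theta_left (y : E) : Continuous fun x : E => theta (CompactOp H) x y := by
  refine (LipschitzWith.of_dist_le_mul (K := ‖y‖₊) fun x x' => ?_).continuous
  have h : theta (CompactOp H) x y - theta (CompactOp H) x' y = theta (CompactOp H) (x - x') y := by
    rw [sub_eq_iff_eq_add, ← theta_add_left, sub_add_cancel]
  rw [dist_eq_norm, dist_eq_norm, h, mul_comm]
  exact LinearMap.mkContinuous_norm_le _ (by positivity) _

/-- The restriction of a module-compact operator to a corner is a compact operator. -/
theorem isCompactOperator_comp_corner [CompleteSpace E] (ξ : H) (X : Submodule ℂ E) {k : E →L[ℂ] E}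
    (hk : k ∈ moduleCompacts (CompactOp H) E) :
    IsCompactOperator (k ∘L (corner ξ X).subtypeL) := by
  let V := corner ξ X
  let L : (E →L[ℂ] E) →L[ℂ] (V →L[ℂ] E) := (ContinuousLinearMap.compL ℂ V E E).flip V.subtypeL
  have hclosed : IsClosed (compactOperator (RingHom.id ℂ) V E : Set (V →L[ℂ] E)) :=
    isClosed_setOfPred_isCompactOperator
  refine map_mem_of_mem_moduleCompacts (A := CompactOp H) L hclosed (fun x y => ?_) hk
  -- The admissible x form a closed subspace, so it suffices to treat |ζ⟩⟨ζ|x. For these, z = ez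
  -- forces Θ to have rank at most one on the corner.
  let D : Submodule ℂ E :=
    { carrier := {x | L (theta (CompactOp H) x y) ∈ compactOperator (RingHom.id ℂ) V E}
      add_mem' := fun {x x'} h h' => by
        rw [Set.mem_ofPred_eq, theta_add_left, map_add]
        exact Submodule.add_mem _ h h'
      zero_mem' := by
        have h0 : theta (CompactOp H) (0 : E) y = 0 := by
          simpa using theta_smul_left (H := H) 0 (0 : E) y
        rw [Set.mem_ofPred_eq, h0, map_zero]
        exact Submodule.zero_mem _
      smul_mem' := fun c x h => by
        rw [Set.mem_ofPred_eq, theta_smul_left, map_smul]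
        exact Submodule.smul_mem _ _ h }
  have hD : IsClosed (D : Set E) :=
    hclosed.preimage (L.continuous.comp (continuous_theta_left y))
  refine Submodule.topologicalClosure_minimal _ (Submodule.span_le.2 ?_) hD
    (mem_closure_span_ketBra (H := H) x)
  rintro _ ⟨ζ, rfl⟩
  change IsCompactOperator _
  refine isCompactOperator_of_forall_mem _ (Submodule.span ℂ {ketBra ξ ζ • y}) fun z => ?_
  have hz : theta (CompactOp H) (ketBra ζ ζ • x) y (z : E) =
      inner ℂ ξ ((inner (CompactOp H) x (z : E)).toCLM ζ) • (ketBra ξ ζ • y) := by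
    conv_lhs => rw [← (mem_corner.1 z.2).2]
    rw [theta_apply, CStarModule.inner_op_smul_left, CStarModule.inner_op_smul_right, star_ketBra,
      ketBra_mul_mul_ketBra, smul_act]
  change theta (CompactOp H) (ketBra ζ ζ • x) y (z : E) ∈ _
  rw [hz]
  exact Submodule.smul_mem _ _ (Submodule.mem_span_singleton_self _)

/-- A closed submodule fixed by a module-compact operator has finite-dimensional corners. -/
theorem finiteDimensional_corner [CompleteSpace E] (ξ : H) {X : Submodule ℂ E} (hX : IsClosed (X : Set E))
    {k : E →L[ℂ] E} (hk : k ∈ moduleCompacts (CompactOp H) E) (hkX : ∀ x ∈ X, k x = x) :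
    FiniteDimensional ℂ (corner ξ X) := by
  have h1 := isCompactOperator_comp_corner ξ X hk
  have h2 : ∀ z : corner ξ X, (k ∘L (corner ξ X).subtypeL) z ∈ corner ξ X := fun z => by
    change k z ∈ _
    rw [hkX z (mem_corner.1 z.2).1]
    exact z.2
  have h3 := h1.codRestrict h2 (isClosed_corner ξ hX)
  refine FiniteDimensional.of_isCompactOperator_id (𝕜 := ℂ) ?_
  have h4 : (id : corner ξ X → corner ξ X) =
      Set.codRestrict (k ∘L (corner ξ X).subtypeL) _ h2 :=
    funext fun z => Subtype.ext (hkX z (mem_corner.1 z.2).1).symm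
  rw [h4]
  exact h3

theorem inner_corner {ξ : H} {X : Submodule ℂ E} (x y : corner ξ X) :
    inner (CompactOp H) (x : E) (y : E) =
      inner ℂ ξ ((inner (CompactOp H) (x : E) (y : E)).toCLM ξ) • ketBra ξ ξ := by
  conv_lhs => rw [← (mem_corner.1 x.2).2, ← (mem_corner.1 y.2).2]
  rw [CStarModule.inner_op_smul_left, CStarModule.inner_op_smul_right, star_ketBra,
    ketBra_mul_mul_ketBra]

/-- A corner is an inner product space, with `⟨x, y⟩ = c e` for the scalar product `c`. -/
@[reducible]
noncomputable def cornerInnerProductSpace {ξ : H} (hξ : ‖ξ‖ = 1) (X : Submodule ℂ E) :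
    InnerProductSpace ℂ (corner ξ X) where
  inner x y := inner ℂ ξ ((inner (CompactOp H) (x : E) (y : E)).toCLM ξ)
  norm_sq_eq_re_inner x := by
    have h1 : ‖x‖ ^ 2 = ‖inner (CompactOp H) (x : E) (x : E)‖ :=
      CStarModule.norm_sq_eq (CompactOp H) (x := (x : E))
    have he : ‖ketBra ξ ξ‖ = 1 := by
      rw [← CompactOp.norm_toCLM, toCLM_ketBra, InnerProductSpace.norm_rankOne, hξ, one_mul]
    -- Writing ⟨x, x⟩ = b⋆b shows that its scalar is ‖bξ‖² ≥ 0; as ‖e‖ = 1, the given norm is the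
    -- one of this inner product.
    obtain ⟨b, hb⟩ := CStarAlgebra.nonneg_iff_eq_star_mul_self.1
      (CStarModule.inner_self_nonneg (A := CompactOp H) (x := (x : E)))
    have h2 : inner ℂ ξ ((inner (CompactOp H) (x : E) (x : E)).toCLM ξ) =
        ((‖b.toCLM ξ‖ ^ 2 : ℝ) : ℂ) := by
      rw [hb, CompactOp.toCLM_mul, mul_apply_eq_comp, ← CompactOp.inner_star_left, star_star,
        inner_self_eq_norm_sq_to_K]
      norm_cast
    have h3 := congrArg norm (inner_corner x x)
    rw [norm_smul, he, mul_one, h2, Complex.norm_real, norm_pow, norm_norm] at h3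
    rw [h1, h3, h2]
    exact (Complex.ofReal_re _).symm
  conj_inner_symm x y := by
    rw [inner_conj_symm, ← CompactOp.inner_star_left, CStarModule.star_inner]
  add_left x y z := by
    simp [CompactOp.toCLM_add]
  smul_left x y c := by
    simp [CompactOp.toCLM_smul]

/-- The vector `|ξ⟩⟨η| x` lies in the corner. -/
theorem ketBra_act_mem_corner {ξ : H} (hξ : ‖ξ‖ = 1) {X : Submodule ℂ E}
    (hX : ∀ (a : CompactOp H), ∀ x ∈ X, a • x ∈ X) (η : H) {x : E} (hx : x ∈ X) :
    ketBra ξ η • x ∈ corner ξ X :=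
  ⟨hX _ x hx, by rw [← mul_act, ketBra_mul_ketBra_of_norm_eq_one hξ]⟩

/-- An orthonormal basis of a corner is an orthonormal basis of the module. -/
theorem exists_isOrthonormalBasis {ξ : H} (hξ : ‖ξ‖ = 1) {X : Submodule ℂ E}
    (hXc : IsClosed (X : Set E)) (hX : ∀ (a : CompactOp H), ∀ x ∈ X, a • x ∈ X)
    [FiniteDimensional ℂ (corner ξ X)] : ∃ B : Set E, IsOrthonormalBasis (CompactOp H) X B := by
  let := cornerInnerProductSpace hξ X
  let b := stdOrthonormalBasis ℂ (corner ξ X)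
  have hb : ∀ i j, inner (CompactOp H) (b i : E) (b j : E) =
      inner ℂ (b i) (b j) • ketBra ξ ξ := fun i j => inner_corner (b i) (b j)
  refine ⟨Set.range fun i => (b i : E), ?_, ?_, le_antisymm ?_ ?_⟩
  · rintro _ ⟨i, rfl⟩
    have h1 : inner ℂ (b i) (b i) = (1 : ℂ) := by
      rw [inner_self_eq_norm_sq_to_K, b.norm_eq_one]; simp
    dsimp only
    rw [hb, h1, one_smul]
    exact isMinimalProjection_ketBra hξ
  · rintro _ ⟨i, rfl⟩ _ ⟨j, rfl⟩ hij
    have h1 : i ≠ j := fun h => hij (by rw [h])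
    dsimp only
    rw [hb, b.inner_eq_zero h1, zero_smul]
  · refine Submodule.topologicalClosure_minimal _ (Submodule.span_le.2 ?_) hXc
    rintro _ (⟨i, rfl⟩ | ⟨a, _, ⟨i, rfl⟩, rfl⟩)
    · exact (mem_corner.1 (b i).2).1
    · exact hX _ _ (mem_corner.1 (b i).2).1
  · intro x hx
    refine Submodule.topologicalClosure_mono (Submodule.span_le.2 ?_)
      (mem_closure_span_ketBra (H := H) x)
    rintro _ ⟨ζ, rfl⟩
    let v : corner ξ X := ⟨ketBra ξ ζ • x, ketBra_act_mem_corner hξ hX ζ hx⟩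
    have hv : (v : E) = ∑ i, inner ℂ (b i) v • (b i : E) := by
      conv_lhs => rw [← b.sum_repr' v]
      push_cast
      rfl
    -- |ζ⟩⟨ζ|x = |ζ⟩⟨ξ|(|ξ⟩⟨ζ|x) factors through the corner, where the basis expansion applies.
    have h1 : ketBra ζ ζ • x = actL (ketBra ζ ξ) (v : E) := by
      rw [actL_apply, ← mul_act, ketBra_mul_ketBra_of_norm_eq_one hξ]
    dsimp only
    rw [h1, hv, map_sum]
    refine Submodule.sum_mem _ fun i _ => ?_
    rw [map_smul]
    exact Submodule.smul_mem _ _ (Submodule.subset_span (Or.inr ⟨_, _, ⟨i, rfl⟩, rfl⟩))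

/-- An orthonormal basis of `X` gives a basis of the corner. -/
theorem IsOrthonormalBasis.mk_eq_finrank {ξ : H} (hξ : ‖ξ‖ = 1) {X : Submodule ℂ E}
    (hX : ∀ (a : CompactOp H), ∀ x ∈ X, a • x ∈ X) [FiniteDimensional ℂ (corner ξ X)]
    {B : Set E} (hB : IsOrthonormalBasis (CompactOp H) X B) :
    Cardinal.mk B = Module.finrank ℂ (corner ξ X) := by
  let := cornerInnerProductSpace hξ X
  have hBX : ∀ x ∈ B, x ∈ X := fun x hx => by
    rw [← hB.dense_span]
    exact Submodule.le_topologicalClosure _ (Submodule.subset_span (Or.inl hx))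
  choose! η hη1 hη using fun x (hx : x ∈ B) => (hB.basic x hx).exists_eq_ketBra
  -- With ⟨x, x⟩ = |η⟩⟨η|, the partial isometry |ξ⟩⟨η| rotates x into the corner; orthonormality is
  -- preserved.
  let v : B → corner ξ X := fun x =>
    ⟨ketBra ξ (η x) • (x : E), ketBra_act_mem_corner hξ hX _ (hBX x x.2)⟩
  have hinner : ∀ x y : B, inner (CompactOp H) (v x : E) (v y : E) =
      ketBra ξ (η y) * inner (CompactOp H) (x : E) (y : E) * ketBra (η x) ξ := fun x y => by
    simp only [v]
    rw [CStarModule.inner_op_smul_left, CStarModule.inner_op_smul_right, star_ketBra]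
  have hv : Orthonormal ℂ v := by
    classical
    rw [orthonormal_iff_ite]
    intro x y
    change inner ℂ ξ ((inner (CompactOp H) (v x : E) (v y : E)).toCLM ξ) = _
    rw [hinner]
    split_ifs with hxy
    · subst hxy
      rw [hη x x.2, ketBra_mul_ketBra_of_norm_eq_one (hη1 x x.2),
        ketBra_mul_ketBra_of_norm_eq_one (hη1 x x.2), ketBra_apply, inner_smul_right,
        inner_self_eq_norm_sq_to_K, hξ]
      simp
    · rw [hB.orthogonal x x.2 y y.2 fun h => hxy (Subtype.ext h), mul_zero, zero_mul,
        CompactOp.toCLM_zero, zero_apply, inner_zero_right]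
  let W : Submodule ℂ E := (Submodule.span ℂ (Set.range v)).map (corner ξ X).subtype
  have hact : ∀ (a : CompactOp H), ∀ x ∈ B, ketBra ξ ξ • (a • x) ∈ W := fun a x hx => by
    -- Inserting x = ⟨x, x⟩x = |η⟩⟨η|x reduces the action of a to a scalar.
    have h1 : ketBra ξ ξ • (a • x) = inner ℂ ξ (a.toCLM (η x)) • (ketBra ξ (η x) • x) := by
      rw [← mul_act, ← smul_act, ← ketBra_mul_mul_ketBra, mul_act _ (ketBra (η x) (η x)), ← hη x hx,
        inner_self_act_self (hB.basic x hx).1.isIdempotentElem]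
    rw [h1]
    exact W.smul_mem _ ⟨v ⟨x, hx⟩, Submodule.subset_span ⟨_, rfl⟩, rfl⟩
  have hXW : X ≤ W.comap (actL (ketBra ξ ξ) : E →L[ℂ] E).toLinearMap := by
    have hWc : IsClosed (W : Set E) := Submodule.closed_of_finiteDimensional W
    rw [← hB.dense_span]
    refine Submodule.topologicalClosure_minimal _ (Submodule.span_le.2 ?_)
      (hWc.preimage (actL (ketBra ξ ξ) : E →L[ℂ] E).continuous)
    rintro _ (hx | ⟨a, x, hx, rfl⟩)
    · rename_i x
      have := hact (inner (CompactOp H) x x) x hx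
      rwa [inner_self_act_self (hB.basic x hx).1.isIdempotentElem] at this
    · exact hact a x hx
  have hspan : ⊤ ≤ Submodule.span ℂ (Set.range v) := fun z _ => by
    have h1 : ketBra ξ ξ • (z : E) ∈ W := hXW (mem_corner.1 z.2).1
    rw [(mem_corner.1 z.2).2] at h1
    obtain ⟨z', hz', h2⟩ := h1
    rwa [← Subtype.ext h2]
  rw [(Module.Basis.mk hv.linearIndependent hspan).mk_eq_rank'', Module.finrank_eq_rank]

/-- A closed submodule fixed by a module-compact operator has a finite orthonormal dimension. -/
theorem exists_hasOrthonormalDim [CompleteSpace E] {X : Submodule ℂ E}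
    (hXc : IsClosed (X : Set E)) (hX : ∀ (a : CompactOp H), ∀ x ∈ X, a • x ∈ X)
    {k : E →L[ℂ] E} (hk : k ∈ moduleCompacts (CompactOp H) E) (hkX : ∀ x ∈ X, k x = x) :
    ∃ n : ℕ, HasOrthonormalDim (CompactOp H) X n := by
  rcases subsingleton_or_nontrivial H with hH | hH
  -- If H = 0 there is no unit vector, but then 𝒦 and E vanish and the only orthonormal basis is
  -- empty.
  · have hA : ∀ a : CompactOp H, a = 0 := fun a =>
      CompactOp.ext fun x => Subsingleton.elim _ _
    have hE : ∀ x : E, x = 0 := fun x => CStarModule.inner_self.1 (hA (inner (CompactOp H) x x))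
    have hbasis : ∀ B : Set E, IsOrthonormalBasis (CompactOp H) X B → B = ∅ := fun B hB =>
      Set.eq_empty_of_forall_notMem fun x hx => (hB.basic x hx).2.1 (hA _)
    refine ⟨0, ⟨∅, by simp, by simp, ?_⟩, fun B hB => by rw [hbasis B hB]; simp⟩
    have : Subsingleton E := ⟨fun x y => by rw [hE x, hE y]⟩
    exact Subsingleton.elim _ _
  · obtain ⟨ξ, hξ⟩ := exists_norm_eq H zero_le_one
    have := finiteDimensional_corner ξ hXc hk hkX
    exact ⟨_, exists_isOrthonormalBasis hξ hXc hX, fun B hB => hB.mk_eq_finrank hξ hX⟩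

/-- If `S T - 1` is module-compact, the kernel of `T` has a finite orthonormal dimension. -/
theorem exists_hasOrthonormalDim_ker [CompleteSpace E] {T T' S : E →L[ℂ] E}
    (hT : IsAdjPair (CompactOp H) T T')
    (h : S * T - 1 ∈ moduleCompacts (CompactOp H) E) :
    ∃ n : ℕ, HasOrthonormalDim (CompactOp H) (LinearMap.ker (T : E →ₗ[ℂ] E)) n := by
  -- The module-compact operator 1 - ST is the identity on Ker T.
  refine exists_hasOrthonormalDim T.isClosed_ker (fun a x hx => ?_) (Submodule.neg_mem _ h)
    fun x hx => ?_
  · have hx' : T x = 0 := hx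
    change T (a • x) = 0
    rw [hT.map_act, hx']
    exact (actL a : E →L[ℂ] E).map_zero
  · have hx' : T x = 0 := hx
    simp [hx']

end Dimension

end HilbertModule

theorem mainTheorem3
    {H : Type*} [NormedAddCommGroup H] [InnerProductSpace ℂ H] [CompleteSpace H]
    {E : Type*} [NormedAddCommGroup E] [NormedSpace ℂ E] [CompleteSpace E]
    [SMul (HilbertModule.CompactOp H) E] [CStarModule (HilbertModule.CompactOp H) E]
    (t : E →ₗ.[ℂ] E)
    (ht : HilbertModule.IsRegular (HilbertModule.CompactOp H) t)
    (htF : HilbertModule.IsFredholm (HilbertModule.CompactOp H) t) :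
    ∃ F : HilbertModule.Adjointable (HilbertModule.CompactOp H) E,
      -- `F = F_t` is the bounded transform of `t`, and `F⋆` is that of `t⋆`
      HilbertModule.IsBoundedTransform t F ∧
      (∀ F' : HilbertModule.Adjointable (HilbertModule.CompactOp H) E,
        HilbertModule.IsBoundedTransform t F' → F' = F) ∧
      HilbertModule.IsBoundedTransform
        (HilbertModule.padjoint (HilbertModule.CompactOp H) t) F.conj ∧
      F.IsFredholm ∧
      -- equality of the kernels
      HilbertModule.pker t = LinearMap.ker (F.op : E →ₗ[ℂ] E) ∧
      HilbertModule.pker (HilbertModule.padjoint (HilbertModule.CompactOp H) t) =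
        LinearMap.ker (F.conj.op : E →ₗ[ℂ] E) ∧
      -- the dimensions of the kernels are well defined and finite
      (∃ m n : ℕ,
        HilbertModule.HasOrthonormalDim (HilbertModule.CompactOp H)
          (HilbertModule.pker t) m ∧
        HilbertModule.HasOrthonormalDim (HilbertModule.CompactOp H)
          (HilbertModule.pker (HilbertModule.padjoint (HilbertModule.CompactOp H) t)) n) ∧
      -- equality of the indices
      HilbertModule.index (HilbertModule.CompactOp H) t = F.index := by
  obtain ⟨Q, F, Q', F', h, hgr⟩ := ht.exists_transform
  have hgr' := h.mem_graph_padjoint_iff ht.dense_domain hgr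
  let T : HilbertModule.Adjointable (HilbertModule.CompactOp H) E := ⟨F, F', h.adj⟩
  have hT : T.IsFredholm := h.isFredholm ht.isClosed hgr htF
  have hker : HilbertModule.pker t = LinearMap.ker (T.op : E →ₗ[ℂ] E) := h.pker_eq hgr
  have hker' : HilbertModule.pker (HilbertModule.padjoint (HilbertModule.CompactOp H) t) =
      LinearMap.ker (T.conj.op : E →ₗ[ℂ] E) := h.symm.pker_eq hgr'
  refine ⟨T, (h.isBoundedTransform_iff ht.dense_domain hgr T).2 rfl, fun T' hT' =>
    HilbertModule.Adjointable.ext_op ((h.isBoundedTransform_iff ht.dense_domain hgr T').1 hT'),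
    (h.symm.isBoundedTransform_iff ht.dense_adjoint_domain hgr' T.conj).2 rfl, hT, hker, hker',
    ?_, ?_⟩
  · obtain ⟨⟨S, hS⟩, S', hS'⟩ := hT
    obtain ⟨m, hm⟩ := HilbertModule.exists_hasOrthonormalDim_ker h.adj hS
    obtain ⟨n, hn⟩ := HilbertModule.exists_hasOrthonormalDim_ker h.adj.symm
      -- The adjoint of a right parametrix of F is a left parametrix of F⋆.
      (((h.adj.mul S'.isAdjPair).sub HilbertModule.IsAdjPair.one).conj_mem_moduleCompacts hS')
    exact ⟨m, n, hker ▸ hm, hker' ▸ hn⟩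
  · rw [HilbertModule.index, HilbertModule.Adjointable.index, hker, hker']
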